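/- Let $K$ be a field, $n>k\ge\lfloor n/2\rfloor$ with $k \ge 0$ integers, $R=K[X_1,\dots,X_n]$ with the standard $\mathbb Z^n$-grading ($\deg X_i$ is the $i$-th unit vector), and $\mathfrak m=(X_1,\dots,X_n)$. Let $M(n,k)$ be the $k$-th syzygy module of $K=R/\mathfrak m$, that is, the image of the $k$-th map $\partial$ of the (augmented) Koszul complex $$0\to\textstyle\bigwedge^nR^n\to\cdots\to\bigwedge^2R^n\to R^n\to R\to K\to 0,\qquad \partial(e_{i_1}\wedge\dots\wedge e_{i_k})=\sum_{j=1}^k(-1)^{j+1}X_{i_j}\,e_{i_1}\wedge\dots\wedge\widehat{e_{i_j}}\wedge\dots\wedge e_{i_k}\quad(k\ge1),$$ where for $k=0$ the map is the augmentation $R\to K$ (so $M(n,0)=K$; this occurs only for $n=1$). A Stanley decomposition of a finitely generated $\mathbb Z^n$-graded $R$-module $M$ is a finite family $(K[Z_i],m_i)_{i\in I}$ with $Z_i\subseteq\{X_1,\dots,X_n\}$ and $m_i\in M$ homogeneous, such that each $K[Z_i]m_i$ is a free $K[Z_i]$-module with basis $m_i$ and $M=\bigoplus_{i\in I}K[Z_i]m_i$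 as a $K$-vector space. Its depth is the depth of the $R$-module $\bigoplus_{i\in I}K[Z_i]$, where $K[Z]=R/(X_j : X_j\notin Z)$ (the supremum of the lengths of the regular sequences in $\mathfrak m$), and the Stanley depth $\operatorname{sdepth}M$ is the maximal depth of a Stanley decomposition of $M$. For $G\subseteq[n]=\{1,\dots,n\}$ and $0\le g\le n$ put $\rho_G(g)=|G\cap[g]|-|[g]\setminus G|$, let $N(G)$ be the set of those $g\in G\cup\{0\}$ at which $\rho_G$ attains its maximum over $G\cup\{0\}$, and $\nu(G)=\min N(G)$. Let $\psi(G)=G\setminus\{\nu(G)\}$ if $\nu(G)>0$, and let $\psi(G)$ be undefined otherwise. Let $\mathcal S$ be the set of all $S\subseteq[n]$ such that $|S|-k$ is even and nonnegative. For $S\in\mathcal S$ let $Z_S=\{X_1,\dots,X_n\}\setminus\{X_s\}$ if $S=\psi(S\cup\{s\})$ for some $s \notin S$, and $Z_S=\{X_1,\dots,X_n\}$ if $S$ is not in the image of $\psi$. Then: 1. $\operatorname{sdepth}M(n,k)=n-1$. 2. $\psi$ is the lexicographic mapping: if each level of the Boolean algebra of subsets of $[n]$ is run through in lexicographic order, then,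 for $|G|=l+1$, $\psi(G)$ is the lexicographically smallest $l$-subset of $G$ that is not the image of an earlier $(l+1)$-set, and $\psi(G)$ is undefined if there is no such subset. 3. For every $S\in\mathcal S$ the set $G(S)=\psi^{|S|-k}(S)$ is defined and is a $k$-set. The element $m_S=X^{S\setminus G(S)}\,\partial(e_{G(S)})\in M(n,k)$, where $X^{A}=\prod_{i\in A}X_i$, has multidegree $S$ (i.e. the indicator vector of $S$), and $(K[Z_S],m_S)_{S\in\mathcal S}$ is a Stanley decomposition of $M(n,k)$. -/

import Mathlib

/-! ### Stanley decompositions and Stanley depth of multigraded modules -/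

/-- The homogeneous maximal ideal `(X_1, …, X_n)` of `K[X_1, …, X_n]`. -/
noncomputable def maxHomIdeal (K : Type*) [Field K] (n : ℕ) : Ideal (MvPolynomial (Fin n) K) :=
  Ideal.span (Set.range MvPolynomial.X)

/-- Depth of a module `N` over `R = K[X_1, …, X_n]`: the supremum of the lengths of the
`N`-regular sequences in the homogeneous maximal ideal. (For `N` finitely generated, graded and
nonzero, `𝔪 N ≠ N` holds automatically, so that "weakly regular" is the same as "regular";
the zero module has depth `⊤`.) -/
noncomputable def polyDepth (K : Type*) [Field K] (n : ℕ) (N : Type*) [AddCommGroup N]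
    [Module (MvPolynomial (Fin n) K) N] : ℕ∞ :=
  ⨆ (rs : List (MvPolynomial (Fin n) K))
    (_ : (∀ r ∈ rs, r ∈ maxHomIdeal K n) ∧ RingTheory.Sequence.IsWeaklyRegular N rs),
    (rs.length : ℕ∞)

/-- The `K`-subspace `K[Z] m` of a module `M`. -/
noncomputable def stanleySpace {K : Type*} [Field K] {n : ℕ} {M : Type*} [AddCommGroup M]
    [Module K M] [Module (MvPolynomial (Fin n) K) M] [IsScalarTower K (MvPolynomial (Fin n) K) M]
    (Z : Finset (Fin n)) (m : M) : Submodule K M :=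
  (Subalgebra.toSubmodule (MvPolynomial.supported K (Z : Set (Fin n)))).map
    ((LinearMap.toSpanSingleton (MvPolynomial (Fin n) K) M m).restrictScalars K)

/-- `(K[Z_i], m_i)_{i ∈ ι}` is a Stanley decomposition of the `ℤ^n`-graded module `M` whose
component of degree `a` is `𝓜 a`: every `m_i` is homogeneous, every `K[Z_i] m_i` is free over
`K[Z_i]` with basis `m_i`, and `M` is the internal direct sum of the finitely many
`K`-subspaces `K[Z_i] m_i`. -/
structure IsStanleyDecomposition {K : Type*} [Field K] {n : ℕ} {M : Type*} [AddCommGroup M]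
    [Module K M] [Module (MvPolynomial (Fin n) K) M] [IsScalarTower K (MvPolynomial (Fin n) K) M]
    (𝓜 : (Fin n → ℤ) → Submodule K M) {ι : Type*} [Fintype ι] [DecidableEq ι]
    (Z : ι → Finset (Fin n)) (m : ι → M) : Prop where
  homogeneous : ∀ i, ∃ a, m i ∈ 𝓜 a
  free : ∀ i, ∀ f ∈ MvPolynomial.supported K (Z i : Set (Fin n)), f • m i = 0 → f = 0
  isInternal : DirectSum.IsInternal (fun i => stanleySpace (K := K) (Z i) (m i))

/-- The depth of a decomposition `(K[Z_i], m_i)_{i ∈ ι}`, i.e. the depth of the `R`-module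
`⨁ K[Z_i]`, where `K[Z] = R / (X_j | j ∉ Z)`. (Degree shifts do not matter for the depth.) -/
noncomputable def decompositionDepth (K : Type*) [Field K] {n : ℕ} {ι : Type*}
    (Z : ι → Finset (Fin n)) : ℕ∞ :=
  polyDepth K n (DirectSum ι fun i => MvPolynomial (Fin n) K ⧸
    Ideal.span ((MvPolynomial.X : Fin n → MvPolynomial (Fin n) K) '' {j | j ∉ Z i}))

/-- The Stanley depth: the supremum of the depths of all Stanley decompositions. -/
noncomputable def stanleyDepth {K : Type*} [Field K] {n : ℕ} {M : Type*} [AddCommGroup M]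
    [Module K M] [Module (MvPolynomial (Fin n) K) M] [IsScalarTower K (MvPolynomial (Fin n) K) M]
    (𝓜 : (Fin n → ℤ) → Submodule K M) : ℕ∞ :=
  sSup {d | ∃ (r : ℕ) (Z : Fin r → Finset (Fin n)) (m : Fin r → M),
    IsStanleyDecomposition 𝓜 Z m ∧ d = decompositionDepth K Z}

/-! ### The Koszul complex and the syzygy modules of `K` -/

/-- The direct sum of all modules of the augmented Koszul complex
`0 → ⋀^n R^n → ⋯ → R^n → R → K → 0`, with `K = R/𝔪`. -/
abbrev KoszulTotal (K : Type*) [Field K] (n : ℕ) : Type _ :=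
  ExteriorAlgebra (MvPolynomial (Fin n) K) (Fin n → MvPolynomial (Fin n) K) ×
    (MvPolynomial (Fin n) K ⧸ maxHomIdeal K n)

/-- The `k`-th map of the augmented Koszul complex, on `⋀^k R^n`. The first component is the
contraction with the linear form `e_i ↦ X_i`, i.e. the Koszul differential
`e_{i_1} ∧ ⋯ ∧ e_{i_k} ↦ ∑ j, (-1)^(j+1) X_{i_j} e_{i_1} ∧ ⋯ ∧ ê_{i_j} ∧ ⋯ ∧ e_{i_k}`.
The second component is the augmentation `R → R/𝔪` if `k = 0`, and it is zero if `k ≥ 1`. -/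
noncomputable def koszulBoundary (K : Type*) [Field K] (n k : ℕ) :
    (⋀[MvPolynomial (Fin n) K]^k (Fin n → MvPolynomial (Fin n) K))
      →ₗ[MvPolynomial (Fin n) K] KoszulTotal K n :=
  (LinearMap.prod
    (CliffordAlgebra.contractLeft
      (Q := (0 : QuadraticForm (MvPolynomial (Fin n) K) (Fin n → MvPolynomial (Fin n) K)))
      (Fintype.linearCombination (MvPolynomial (Fin n) K) MvPolynomial.X))
    ((maxHomIdeal K n).mkQ ∘ₗ ExteriorAlgebra.algebraMapInv.toLinearMap)) ∘ₗ
  (⋀[MvPolynomial (Fin n) K]^k (Fin n → MvPolynomial (Fin n) K)).subtype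

/-- `M(n,k)`, the `k`-th syzygy module of `K`: the image of the `k`-th map of the augmented
Koszul complex. -/
noncomputable def koszulSyzygy (K : Type*) [Field K] (n k : ℕ) :
    Submodule (MvPolynomial (Fin n) K) (KoszulTotal K n) :=
  LinearMap.range (koszulBoundary K n k)

/-- The element `∂(e_G)` of `M(n,k)`, for a `k`-set `G`; here `e_G = e_{i_1} ∧ ⋯ ∧ e_{i_k}` for
`G = {i_1 < ⋯ < i_k}`. -/
noncomputable def koszulGen (K : Type*) [Field K] (n k : ℕ) (G : Set.powersetCard (Fin n) k) :
    koszulSyzygy K n k :=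
  (koszulBoundary K n k).rangeRestrict
    (exteriorPower.ιMulti_family (MvPolynomial (Fin n) K) k
      (fun i => (Pi.single i 1 : Fin n → MvPolynomial (Fin n) K)) G)

/-- The multidegree of a set `S`, i.e. its `0/1`-indicator vector. -/
def setDegree {n : ℕ} (S : Finset (Fin n)) : Fin n → ℤ := fun i => if i ∈ S then 1 else 0

/-- The component of multidegree `a` of the augmented Koszul complex: it is spanned over `K` by
the `X^b e_T` with `b + deg T = a`, and by `1 ∈ R/𝔪` if `a = 0`. -/
noncomputable def koszulTotalGrading (K : Type*) [Field K] (n : ℕ) (a : Fin n → ℤ) :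
    Submodule K (KoszulTotal K n) :=
  Submodule.span K
    ({x | ∃ (b : Fin n →₀ ℕ) (T : Finset (Fin n)), (∀ i, (b i : ℤ) + setDegree T i = a i) ∧
        x = (MvPolynomial.monomial b (1 : K) •
          ExteriorAlgebra.ιMulti_family (MvPolynomial (Fin n) K) T.card
            (fun i => (Pi.single i 1 : Fin n → MvPolynomial (Fin n) K)) ⟨T, rfl⟩, 0)} ∪
      {x | a = 0 ∧ x = (0, 1)})

/-- The multigrading of `M(n,k)` inherited from the augmented Koszul complex. -/
noncomputable def koszulGrading (K : Type*) [Field K] (n k : ℕ) (a : Fin n → ℤ) :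
    Submodule K (koszulSyzygy K n k) :=
  (koszulTotalGrading K n a).comap ((koszulSyzygy K n k).subtype.restrictScalars K)

/-! ### The lexicographic matching in the Boolean algebra

The ground set `{1, …, n}` is represented by `Fin n`, where `i : Fin n` stands for the number
`i + 1`. -/

/-- `ρ_G(g) = ∑_{1 ≤ j ≤ g} χ_G(j)` for `g ∈ {0, …, n}`, with `χ_G(j) = 1` if `j ∈ G` and `-1`
otherwise. -/
def rho {n : ℕ} (G : Finset (Fin n)) (g : ℕ) : ℤ :=
  ∑ j : Fin n, if (j : ℕ) + 1 ≤ g then (if j ∈ G then 1 else -1) else 0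

/-- The set `G ∪ {0}`, as a set of natural numbers. -/
def withZero {n : ℕ} (G : Finset (Fin n)) : Finset ℕ :=
  insert 0 (G.image fun i : Fin n => (i : ℕ) + 1)

/-- `N(G)`: the elements of `G ∪ {0}` at which `ρ_G` takes its maximum over `G ∪ {0}`. -/
def maxPlaces {n : ℕ} (G : Finset (Fin n)) : Finset ℕ :=
  (withZero G).filter fun g => ∀ h ∈ withZero G, rho G h ≤ rho G g

theorem maxPlaces_nonempty {n : ℕ} (G : Finset (Fin n)) : (maxPlaces G).Nonempty := by
  obtain ⟨g, hg, h⟩ := (withZero G).exists_max_image (rho G) ⟨0, by simp [withZero]⟩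
  exact ⟨g, by simpa [maxPlaces] using ⟨hg, h⟩⟩

/-- `ν(G) = min N(G)`. -/
def nu {n : ℕ} (G : Finset (Fin n)) : ℕ := (maxPlaces G).min' (maxPlaces_nonempty G)

/-- The partial map `ψ`: `ψ(G) = G \ {ν(G)}` if `ν(G) > 0`, and `ψ(G)` is undefined
otherwise. -/
def psi {n : ℕ} (G : Finset (Fin n)) : Option (Finset (Fin n)) :=
  if 0 < nu G then some (G.filter fun i => (i : ℕ) + 1 ≠ nu G) else none

/-- The (partially defined) iterate `ψ^i`. -/
def psiIter {n : ℕ} (i : ℕ) (G : Finset (Fin n)) : Option (Finset (Fin n)) :=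
  (fun o => o.bind psi)^[i] (some G)

/-- The lexicographic order on sets of the same size: `G` comes before `H`. -/
def LexLT {n : ℕ} (G H : Finset (Fin n)) : Prop :=
  ∃ i ∈ G, i ∉ H ∧ ∀ j < i, (j ∈ G ↔ j ∈ H)

/-- `T` is a subset of `G` with one element less that is not the image under `f` of a set of the
size of `G` coming before `G` in the lexicographic order. -/
def LexAvailable {n : ℕ} (f : Finset (Fin n) → Option (Finset (Fin n)))
    (G T : Finset (Fin n)) : Prop :=
  T ⊆ G ∧ T.card + 1 = G.card ∧ ∀ H : Finset (Fin n), H.card = G.card → LexLT H G → f H ≠ some T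

/-- `f` is the lexicographic mapping: going through each level of the Boolean algebra in
lexicographic order, `f G` is the lexicographically smallest available subset of `G` if there is
one, and it is undefined otherwise. -/
def IsLexicographicMapping {n : ℕ} (f : Finset (Fin n) → Option (Finset (Fin n))) : Prop :=
  ∀ G T : Finset (Fin n), f G = some T ↔
    LexAvailable f G T ∧ ∀ T', LexAvailable f G T' → ¬ LexLT T' T

/-! ### The explicit decomposition -/

/-- The index set `𝒮` of all `S ⊆ [n]` with `|S| = k + j`, `j ≥ 0` even. -/
abbrev KoszulIndex (n k : ℕ) : Type :=
  {S : Finset (Fin n) // k ≤ S.card ∧ Even (S.card - k)}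

/-- `Z_S`: all variables, except for the variable `s` with `ψ(S ∪ {s}) = S` if `S` is in the
image of `ψ`. -/
def koszulZ {n : ℕ} (S : Finset (Fin n)) : Finset (Fin n) :=
  Finset.univ.filter fun s => psi (insert s S) ≠ some S

/-!
A subset `T` of `{1, …, n}` is read as a lattice path with an ascending step at each element of `T`
and a descending step elsewhere. In this language `psi` flips the step by which the path first
reaches its maximum, and its inverse flips the step after the last maximum (`psi_eq_some_iff`).
Hence `psi` is injective, and it is defined on every set with more than `n / 2` elements. If an
element after `nu G` is removed from `G`, the resulting set is the image of a lexicographically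
earlier set (`exists_lexLT_psi_eq_erase`), which makes `psi` the lexicographic mapping.

In a multidegree with support `A`, the Koszul complex is the augmented chain complex of the simplex
on `A`, and `K[Z_S] m_S` contributes exactly when `S ⊆ A` is not the image of a subset of `A`; its
contribution is then a multiple of the boundary of the face `G(S)`. The sets `G(S)` that occur are
the `k`-subsets of `A` at even distance from the top of their `psi`-chain within `A`
(`evenFace_iff`), and all other `k`-subsets of `A` are the images `psi H` of the `(k + 1)`-subsets
`H` at even distance. So it suffices that the faces at even distance form a basis of the chains
modulo boundaries. The matching `H ↦ psi H` is not acyclic on all faces, but it is so on the `H` at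
even distance: if `psi H'` lies in `H ≠ H'`, then `H'` is lexicographically smaller than `H`
(`lexLT_of_psi_subset`). The reason is that if it were larger, then `H` and `psi H'` would have the
same elements added along their chains (`evenInChain_erase_iff`), so that `H` and `H'` could not
both have even distance. Acyclicity gives spanning (`chainsOn_le_sup`), and, through the
exactness of the Koszul complex, triangularity gives independence (`eq_zero_of_eq_faceBoundary`).

Each `Z_S` misses at most one variable, and the differences of consecutive variables form a regular
sequence of length `n - 1` on each `K[Z_S]`, so the Stanley depth is at least `n - 1`. Conversely, a
decomposition in which all `Z_i` consist of all variables would make `M(n,k)` free, which the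
relations `∂∂(e_A) = 0` with `|A| = k + 1` prevent (`IsStanleyDecomposition.exists_ne_univ`); and a
summand `K[Z_i]` of dimension less than `n` bounds the depth by `n - 1`
(`decompositionDepth_le`).
-/

/-! ### The path of a set, and the preimages of `psi` -/

section Combinatorics

variable {n : ℕ}

theorem rho_zero (G : Finset (Fin n)) : rho G 0 = 0 := by simp [rho]

theorem rho_succ (G : Finset (Fin n)) (i : Fin n) :
    rho G (i + 1) = rho G i + if i ∈ G then 1 else -1 := by
  have : ∀ j : Fin n, (if (j : ℕ) + 1 ≤ i + 1 then (if j ∈ G then (1 : ℤ) else -1) else 0) =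
      (if (j : ℕ) + 1 ≤ i then (if j ∈ G then 1 else -1) else 0) +
        if j = i then (if i ∈ G then 1 else -1) else 0 := by
    intro j
    rcases lt_trichotomy j i with h | h | h
    · have h' : (j : ℕ) < i := h
      have h1 : (j : ℕ) + 1 ≤ i + 1 := by omega
      have h2 : (j : ℕ) + 1 ≤ i := by omega
      rw [if_pos h1, if_pos h2, if_neg h.ne, add_zero]
    · subst h; simp
    · have h' : (i : ℕ) < j := h
      have h1 : ¬ (j : ℕ) + 1 ≤ i + 1 := by omega
      have h2 : ¬ (j : ℕ) + 1 ≤ i := by omega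
      rw [if_neg h1, if_neg h2, if_neg h.ne', add_zero]
  simp only [rho]
  rw [Finset.sum_congr rfl fun j _ => this j, Finset.sum_add_distrib]
  simp

theorem rho_succ_of_mem {G : Finset (Fin n)} {i : Fin n} (h : i ∈ G) :
    rho G (i + 1) = rho G i + 1 := by simp [rho_succ, h]

theorem rho_succ_of_notMem {G : Finset (Fin n)} {i : Fin n} (h : i ∉ G) :
    rho G (i + 1) = rho G i - 1 := by simp [rho_succ, h, sub_eq_add_neg]

theorem rho_insert {G : Finset (Fin n)} {i : Fin n} (h : i ∉ G) (g : ℕ) :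
    rho (insert i G) g = rho G g + if (i : ℕ) + 1 ≤ g then 2 else 0 := by
  have : ∀ j : Fin n, (if (j : ℕ) + 1 ≤ g then (if j ∈ insert i G then (1 : ℤ) else -1) else 0) =
      (if (j : ℕ) + 1 ≤ g then (if j ∈ G then 1 else -1) else 0) +
        if j = i then (if (i : ℕ) + 1 ≤ g then 2 else 0) else 0 := by
    intro j
    by_cases hj : j = i
    · subst hj
      by_cases hg : (j : ℕ) + 1 ≤ g <;> simp [h, hg]
    · simp [hj]
  simp only [rho]
  rw [Finset.sum_congr rfl fun j _ => this j, Finset.sum_add_distrib]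
  simp

theorem rho_top (G : Finset (Fin n)) : rho G n = 2 * G.card - n := by
  induction G using Finset.induction_on with
  | empty =>
    have : ∀ j : Fin n, (j : ℕ) + 1 ≤ n := fun j => by omega
    simp [rho, this]
  | insert i G hi ih =>
    rw [rho_insert hi, ih, if_pos (by omega), Finset.card_insert_of_notMem hi]
    push_cast
    ring

/-- `p` is the last place at which the path `rho T` takes its maximum over `{0, …, n}`. -/
def LastMax (T : Finset (Fin n)) (p : ℕ) : Prop :=
  p ≤ n ∧ ∀ g ≤ n, rho T g ≤ rho T p ∧ (p < g → rho T g < rho T p)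

/-- `p` is the first place at which the path `rho T` takes its maximum over `{0, …, n}`. -/
def FirstMax (T : Finset (Fin n)) (p : ℕ) : Prop :=
  p ≤ n ∧ ∀ g ≤ n, rho T g ≤ rho T p ∧ (g < p → rho T g < rho T p)

theorem LastMax.unique {T : Finset (Fin n)} {p q : ℕ} (hp : LastMax T p) (hq : LastMax T q) :
    p = q := by
  rcases lt_trichotomy p q with h | h | h
  · have := (hp.2 q hq.1).2 h; have := (hq.2 p hp.1).1; omega
  · exact h
  · have := (hq.2 p hp.1).2 h; have := (hp.2 q hq.1).1; omega

theorem exists_lastMax (T : Finset (Fin n)) : ∃ p, LastMax T p := by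
  obtain ⟨m, hm, hmax⟩ := (Finset.range (n + 1)).exists_max_image (rho T) ⟨0, by simp⟩
  let F := (Finset.range (n + 1)).filter fun g => rho T g = rho T m
  have hF : F.Nonempty := ⟨m, by simp [F, Finset.mem_range.1 hm]⟩
  have h1 := Finset.mem_filter.1 (F.max'_mem hF)
  refine ⟨F.max' hF, by have := Finset.mem_range.1 h1.1; omega, fun g hg => ?_⟩
  rw [h1.2]
  have h2 := hmax g (Finset.mem_range.2 (by omega))
  refine ⟨h2, fun hlt => lt_of_le_of_ne h2 fun heq => ?_⟩
  have := F.le_max' g (Finset.mem_filter.2 ⟨Finset.mem_range.2 (by omega), heq⟩)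
  omega

theorem exists_firstMax (T : Finset (Fin n)) : ∃ p, FirstMax T p := by
  obtain ⟨m, hm, hmax⟩ := (Finset.range (n + 1)).exists_max_image (rho T) ⟨0, by simp⟩
  let F := (Finset.range (n + 1)).filter fun g => rho T g = rho T m
  have hF : F.Nonempty := ⟨m, by simp [F, Finset.mem_range.1 hm]⟩
  have h1 := Finset.mem_filter.1 (F.min'_mem hF)
  refine ⟨F.min' hF, by have := Finset.mem_range.1 h1.1; omega, fun g hg => ?_⟩
  rw [h1.2]
  have h2 := hmax g (Finset.mem_range.2 (by omega))
  refine ⟨h2, fun hlt => lt_of_le_of_ne h2 fun heq => ?_⟩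
  have := F.min'_le g (Finset.mem_filter.2 ⟨Finset.mem_range.2 (by omega), heq⟩)
  omega

/-- A path can reach its maximum for the first time only by an ascending step. -/
theorem FirstMax.mem {T : Finset (Fin n)} {p : Fin n} (h : FirstMax T (p + 1)) : p ∈ T := by
  by_contra hp
  have h1 := rho_succ_of_notMem hp
  have := (h.2 p (by omega)).1
  omega

theorem LastMax.notMem {T : Finset (Fin n)} {p : Fin n} (h : LastMax T p) : p ∉ T := by
  intro hp
  have h1 := rho_succ_of_mem hp
  have := (h.2 (p + 1) (by omega)).1
  omega

theorem FirstMax.mem_withZero {T : Finset (Fin n)} {p : ℕ} (h : FirstMax T p) :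
    p ∈ withZero T := by
  rcases p with _ | p
  · simp [withZero]
  · have hp : p < n := h.1
    simp only [withZero, Finset.mem_insert, Finset.mem_image]
    exact Or.inr ⟨⟨p, hp⟩, FirstMax.mem (p := ⟨p, hp⟩) h, rfl⟩

theorem le_of_mem_withZero {T : Finset (Fin n)} {p : ℕ} (h : p ∈ withZero T) : p ≤ n := by
  simp only [withZero, Finset.mem_insert, Finset.mem_image] at h
  rcases h with rfl | ⟨i, -, rfl⟩ <;> omega

/-- The maximum over `G ∪ {0}` in the definition of `nu` may be taken over `{0, …, n}`. -/
theorem FirstMax.nu_eq {T : Finset (Fin n)} {p : ℕ} (h : FirstMax T p) : nu T = p := by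
  have hp : p ∈ maxPlaces T := Finset.mem_filter.2
    ⟨h.mem_withZero, fun g hg => (h.2 g (le_of_mem_withZero hg)).1⟩
  refine le_antisymm (Finset.min'_le _ _ hp) (Finset.le_min' _ _ _ fun g hg => ?_)
  obtain ⟨hg, hmax⟩ := Finset.mem_filter.1 hg
  by_contra hlt
  have := (h.2 g (le_of_mem_withZero hg)).2 (by omega)
  have := hmax p h.mem_withZero
  omega

theorem firstMax_nu (T : Finset (Fin n)) : FirstMax T (nu T) := by
  obtain ⟨p, hp⟩ := exists_firstMax T
  rwa [hp.nu_eq]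

theorem filter_ne_succ (H : Finset (Fin n)) (p : Fin n) :
    (H.filter fun i : Fin n => (i : ℕ) + 1 ≠ p + 1) = H.erase p := by
  ext i
  simp [Fin.ext_iff, and_comm]

/-- The fundamental description of `psi`: the preimage of `T` arises by turning the step after the
last maximum of the path of `T` into an ascending one. -/
theorem psi_eq_some_iff {H T : Finset (Fin n)} :
    psi H = some T ↔ ∃ p : Fin n, LastMax T p ∧ H = insert p T := by
  constructor
  · intro h
    have hf := firstMax_nu H
    unfold psi at h
    split_ifs at h with hpos
    obtain ⟨p, hp⟩ : ∃ p, nu H = p + 1 := ⟨nu H - 1, by omega⟩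
    have hpn : p < n := by have := hf.1; omega
    lift p to Fin n using hpn
    rw [hp, filter_ne_succ, Option.some_inj] at h
    rw [hp] at hf
    have hm : p ∈ H := hf.mem
    subst h
    refine ⟨p, ⟨by omega, fun g hg => ?_⟩, (Finset.insert_erase hm).symm⟩
    have hr := rho_insert (Finset.notMem_erase p H)
    rw [Finset.insert_erase hm] at hr
    have h1 := hf.2 g hg
    have h2 := rho_succ_of_mem hm
    have h3 := hr g
    have h4 := hr p
    rw [if_neg (by omega)] at h4
    split_ifs at h3 <;> omega
  · rintro ⟨p, hp, rfl⟩
    have hr := rho_insert hp.notMem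
    have h2 := rho_succ_of_notMem hp.notMem
    have hf : FirstMax (insert p T) (p + 1) := by
      refine ⟨by omega, fun g hg => ?_⟩
      have h1 := hp.2 g hg
      rw [hr g, hr (p + 1), if_pos le_rfl]
      split_ifs <;> omega
    unfold psi
    rw [if_pos (by rw [hf.nu_eq]; omega), hf.nu_eq, filter_ne_succ,
      Finset.erase_insert hp.notMem]

theorem psi_injective {G H T : Finset (Fin n)} (hG : psi G = some T) (hH : psi H = some T) :
    G = H := by
  obtain ⟨p, hp, rfl⟩ := psi_eq_some_iff.1 hG
  obtain ⟨q, hq, rfl⟩ := psi_eq_some_iff.1 hH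
  rw [Fin.ext (hp.unique hq)]

theorem psi_subset {H T : Finset (Fin n)} (h : psi H = some T) : T ⊆ H := by
  obtain ⟨p, -, rfl⟩ := psi_eq_some_iff.1 h
  exact Finset.subset_insert _ _

theorem card_of_psi {H T : Finset (Fin n)} (h : psi H = some T) : H.card = T.card + 1 := by
  obtain ⟨p, hp, rfl⟩ := psi_eq_some_iff.1 h
  exact Finset.card_insert_of_notMem hp.notMem

theorem exists_psi_eq_some {H : Finset (Fin n)} (h : n < 2 * H.card) : ∃ T, psi H = some T := by
  have hf := firstMax_nu H
  have h1 := (hf.2 n le_rfl).1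
  have h2 := rho_top H
  have h3 := rho_zero H
  have : 0 < nu H := by
    rcases Nat.eq_zero_or_pos (nu H) with h0 | h0
    · rw [h0] at h1; omega
    · exact h0
  exact ⟨_, if_pos this⟩

/-! ### The lexicographic order -/

theorem not_lexLT_self (G : Finset (Fin n)) : ¬ LexLT G G := fun ⟨_, h, h', _⟩ => h' h

theorem LexLT.trans {F G H : Finset (Fin n)} (h₁ : LexLT F G) (h₂ : LexLT G H) : LexLT F H := by
  obtain ⟨i, hi, hi', hi''⟩ := h₁
  obtain ⟨j, hj, hj', hj''⟩ := h₂
  rcases lt_trichotomy i j with h | h | h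
  · exact ⟨i, hi, fun hH => hi' ((hj'' i h).2 hH),
      fun l hl => (hi'' l hl).trans (hj'' l (hl.trans h))⟩
  · subst h; exact absurd hj hi'
  · exact ⟨j, (hi'' j h).2 hj, hj', fun l hl => (hi'' l (hl.trans h)).trans (hj'' l hl)⟩

theorem lexLT_or_lexLT {G H : Finset (Fin n)} (h : G ≠ H) : LexLT G H ∨ LexLT H G := by
  have hne : (symmDiff G H).Nonempty := by
    rw [Finset.nonempty_iff_ne_empty]
    exact fun h0 => h (symmDiff_eq_bot.1 h0)
  let i := (symmDiff G H).min' hne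
  have hlt : ∀ j < i, (j ∈ G ↔ j ∈ H) := by
    intro j hj
    by_contra hc
    have : j ∈ symmDiff G H := by rw [Finset.mem_symmDiff]; tauto
    exact absurd (Finset.min'_le _ _ this) (not_le.2 hj)
  rcases Finset.mem_symmDiff.1 ((symmDiff G H).min'_mem hne) with ⟨h1, h2⟩ | ⟨h1, h2⟩
  · exact Or.inl ⟨i, h1, h2, hlt⟩
  · exact Or.inr ⟨i, h1, h2, fun j hj => (hlt j hj).symm⟩

theorem wellFounded_lexLT : WellFounded (LexLT (n := n)) := by
  have : IsTrans (Finset (Fin n)) LexLT := ⟨fun _ _ _ => LexLT.trans⟩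
  have : Std.Irrefl (LexLT (n := n)) := ⟨not_lexLT_self⟩
  exact Finite.wellFounded_of_trans_of_irrefl _

theorem wellFounded_swap_lexLT : WellFounded (fun G H : Finset (Fin n) => LexLT H G) := by
  have : IsTrans (Finset (Fin n)) (fun G H => LexLT H G) := ⟨fun _ _ _ h h' => LexLT.trans h' h⟩
  have : Std.Irrefl (fun G H : Finset (Fin n) => LexLT H G) := ⟨not_lexLT_self⟩
  exact Finite.wellFounded_of_trans_of_irrefl _

theorem lexLT_insert_erase {G : Finset (Fin n)} {x y : Fin n} (hx : x ∉ G)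
    (hxy : x < y) : LexLT (insert x (G.erase y)) G := by
  refine ⟨x, Finset.mem_insert_self _ _, hx, fun j hj => ?_⟩
  have h1 : j ≠ x := hj.ne
  have h2 : j ≠ y := (hj.trans hxy).ne
  simp [h1, h2]

/-- Removing from `G` an element after `nu G` yields a set that is the image of an earlier set. -/
theorem exists_lexLT_psi_eq_erase {G : Finset (Fin n)} {y : Fin n} (hy : y ∈ G)
    (h : nu G < y + 1) : ∃ H, LexLT H G ∧ psi H = some (G.erase y) := by
  have hf := firstMax_nu G
  obtain ⟨p, hp⟩ := exists_lastMax (G.erase y)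
  have hr := rho_insert (Finset.notMem_erase y G)
  rw [Finset.insert_erase hy] at hr
  have hs := rho_succ_of_mem hy
  have hpn := hp.1
  -- the path of `G` is maximal at `nu G < y`, and removing `y` lowers the path from `y` on
  have hpy : p < y := by
    by_contra hpy
    have h1 := (hp.2 (nu G) hf.1).1
    have h2 := (hf.2 p hp.1).1
    have h3 := hr (nu G)
    have h4 := hr p
    have h5 := hr y
    rw [if_neg (by omega)] at h3 h5
    rcases eq_or_lt_of_le (not_lt.1 hpy) with h6 | h6
    · have := (hf.2 (y + 1) (by omega)).1
      subst h6
      omega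
    · rw [if_pos (by omega)] at h4
      omega
  lift p to Fin n using by omega
  have hpG : p ∉ G := fun hc => hp.notMem (Finset.mem_erase.2 ⟨ne_of_lt hpy, hc⟩)
  exact ⟨_, lexLT_insert_erase hpG hpy, psi_eq_some_iff.2 ⟨p, hp, rfl⟩⟩

theorem exists_eq_erase {G T : Finset (Fin n)} (h : T ⊆ G) (hc : T.card + 1 = G.card) :
    ∃ y ∈ G, T = G.erase y := by
  obtain ⟨y, hy⟩ := Finset.card_eq_one.1
    (by rw [Finset.card_sdiff_of_subset h]; omega : (G \ T).card = 1)
  have hyG : y ∈ G \ T := hy ▸ Finset.mem_singleton_self y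
  refine ⟨y, (Finset.mem_sdiff.1 hyG).1, ?_⟩
  rw [Finset.erase_eq, ← hy, Finset.sdiff_sdiff_eq_self h]

theorem lexAvailable_of_psi {G T : Finset (Fin n)} (h : psi G = some T) :
    LexAvailable psi G T :=
  ⟨psi_subset h, (card_of_psi h).symm, fun _ _ hlt hH =>
    not_lexLT_self _ (psi_injective hH h ▸ hlt)⟩

theorem isLexicographicMapping_psi : IsLexicographicMapping (psi (n := n)) := by
  have key : ∀ {G T T' : Finset (Fin n)}, psi G = some T → LexAvailable psi G T' →
      ¬ LexLT T' T := by
    rintro G T T' h ⟨h1, h2, h3⟩ hlt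
    obtain ⟨y, hy, rfl⟩ := exists_eq_erase h1 h2
    obtain ⟨p, hp, rfl⟩ := psi_eq_some_iff.1 h
    obtain ⟨i, hi, hi', hi''⟩ := hlt
    have hip : i = p := by
      rw [Finset.mem_erase, Finset.mem_insert] at hi
      tauto
    subst hip
    have hiy : i < y := by
      refine lt_of_le_of_ne (not_lt.1 fun hlt => ?_) (Finset.mem_erase.1 hi).1
      have := (hi'' y hlt).2 ((Finset.mem_insert.1 hy).resolve_left hlt.ne)
      exact Finset.notMem_erase _ _ this
    have hnu : nu (insert i T) = i + 1 := by
      have hf := firstMax_nu (insert i T)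
      unfold psi at h
      split_ifs at h with hpos
      obtain ⟨q, hq⟩ : ∃ q, nu (insert i T) = q + 1 := ⟨nu (insert i T) - 1, by omega⟩
      have hqn : q < n := by have := hf.1; omega
      lift q to Fin n using hqn
      rw [hq, filter_ne_succ, Option.some_inj] at h
      rw [hq]
      by_contra hne
      have : i ∈ T := by
        rw [← h, Finset.mem_erase]
        exact ⟨fun hc => hne (by rw [hc]), Finset.mem_insert_self _ _⟩
      exact hp.notMem this
    obtain ⟨H, hH, hH'⟩ := exists_lexLT_psi_eq_erase hy
      (by rw [hnu]; have : (i : ℕ) < y := hiy; omega)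
    exact h3 H (by rw [card_of_psi hH', Finset.card_erase_add_one hy]) hH hH'
  intro G T
  refine ⟨fun h => ⟨lexAvailable_of_psi h, fun T' h' => key h h'⟩, fun ⟨hav, hmin⟩ => ?_⟩
  rcases hG : psi G with _ | T₀
  · exfalso
    obtain ⟨h1, h2, h3⟩ := hav
    obtain ⟨y, hy, rfl⟩ := exists_eq_erase h1 h2
    have hnu : nu G = 0 := by
      unfold psi at hG
      split_ifs at hG
      omega
    obtain ⟨H, hH, hH'⟩ := exists_lexLT_psi_eq_erase hy (by omega)
    exact h3 H (by rw [card_of_psi hH', Finset.card_erase_add_one hy]) hH hH'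
  · by_contra hne
    rcases lexLT_or_lexLT (fun hc => hne (by rw [hc]) : T₀ ≠ T) with hlt | hlt
    · exact hmin T₀ (lexAvailable_of_psi hG) hlt
    · exact key hG hav hlt

end Combinatorics

/-! ### Chains of `psi` inside a subset, and acyclicity -/

section Chains

variable {n : ℕ}

theorem psiIter_zero (G : Finset (Fin n)) : psiIter 0 G = some G := rfl

theorem psiIter_succ (i : ℕ) (G : Finset (Fin n)) :
    psiIter (i + 1) G = (psiIter i G).bind psi := by
  simp only [psiIter, Function.iterate_succ_apply']

theorem psiIter_subset {i : ℕ} {S T : Finset (Fin n)} (h : psiIter i S = some T) : T ⊆ S := by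
  induction i generalizing T with
  | zero => rw [psiIter_zero, Option.some_inj] at h; exact h ▸ subset_rfl
  | succ i ih =>
    rw [psiIter_succ, Option.bind_eq_some_iff] at h
    obtain ⟨U, hU, hT⟩ := h
    exact (psi_subset hT).trans (ih hU)

theorem card_of_psiIter {i : ℕ} {S T : Finset (Fin n)} (h : psiIter i S = some T) :
    S.card = T.card + i := by
  induction i generalizing T with
  | zero => rw [psiIter_zero, Option.some_inj] at h; rw [h, add_zero]
  | succ i ih =>
    rw [psiIter_succ, Option.bind_eq_some_iff] at h
    obtain ⟨U, hU, hT⟩ := h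
    rw [ih hU, card_of_psi hT]
    ring

theorem exists_psiIter_eq_some {S : Finset (Fin n)} (i : ℕ) (h : n < 2 * (S.card + 1 - i)) :
    ∃ T, psiIter i S = some T := by
  induction i with
  | zero => exact ⟨S, rfl⟩
  | succ i ih =>
    obtain ⟨U, hU⟩ := ih (by omega)
    have := card_of_psiIter hU
    obtain ⟨T, hT⟩ := exists_psi_eq_some (H := U) (by omega)
    exact ⟨T, by rw [psiIter_succ, hU]; exact hT⟩

/-- `S` is the top of its `psi`-chain among the subsets of `A`. -/
def IsChainTop (A S : Finset (Fin n)) : Prop := S ⊆ A ∧ ∀ H ⊆ A, psi H ≠ some S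

/-- `T` has distance `i` from the top of its `psi`-chain among the subsets of `A`. -/
def ChainDist (A T : Finset (Fin n)) (i : ℕ) : Prop := ∃ S, IsChainTop A S ∧ psiIter i S = some T

/-- `T` has even distance from the top of its `psi`-chain among the subsets of `A`. The sets
`G(S)` belonging to multidegrees with support `A` turn out to be exactly these. -/
def EvenInChain (A T : Finset (Fin n)) : Prop := ∃ i, ChainDist A T (2 * i)

variable {A H T : Finset (Fin n)}

theorem psiIter_top_unique {i j : ℕ} {S S' : Finset (Fin n)} (hS : IsChainTop A S) (hS' : IsChainTop A S')
    (h : psiIter i S = some T) (h' : psiIter j S' = some T) : i = j ∧ S = S' := by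
  induction i generalizing j T with
  | zero =>
    rw [psiIter_zero, Option.some_inj] at h
    subst h
    rcases j with _ | j
    · rw [psiIter_zero, Option.some_inj] at h'
      exact ⟨rfl, h'.symm⟩
    · rw [psiIter_succ, Option.bind_eq_some_iff] at h'
      obtain ⟨U, hU, hT⟩ := h'
      exact absurd hT (hS.2 U ((psiIter_subset hU).trans hS'.1))
  | succ i ih =>
    rw [psiIter_succ, Option.bind_eq_some_iff] at h
    obtain ⟨U, hU, hT⟩ := h
    rcases j with _ | j
    · rw [psiIter_zero, Option.some_inj] at h'
      subst h'
      exact absurd hT (hS'.2 U ((psiIter_subset hU).trans hS.1))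
    · rw [psiIter_succ, Option.bind_eq_some_iff] at h'
      obtain ⟨U', hU', hT'⟩ := h'
      obtain rfl := psi_injective hT hT'
      obtain ⟨rfl, rfl⟩ := ih hU hU'
      exact ⟨rfl, rfl⟩

theorem ChainDist.unique {i j : ℕ} (h : ChainDist A T i) (h' : ChainDist A T j) : i = j := by
  obtain ⟨S, hS, hi⟩ := h
  obtain ⟨S', hS', hj⟩ := h'
  exact (psiIter_top_unique hS hS' hi hj).1

theorem ChainDist.psi {i : ℕ} (h : ChainDist A H i) (hT : psi H = some T) :
    ChainDist A T (i + 1) := by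
  obtain ⟨S, hS, hi⟩ := h
  exact ⟨S, hS, by rw [psiIter_succ, hi]; exact hT⟩

theorem exists_chainDist (hT : T ⊆ A) : ∃ i, ChainDist A T i := by
  induction h : A.card - T.card generalizing T with
  | zero =>
    refine ⟨0, T, ⟨hT, fun H hH hc => ?_⟩, rfl⟩
    have := card_of_psi hc
    have := Finset.card_le_card hH
    omega
  | succ m ih =>
    by_cases htop : IsChainTop A T
    · exact ⟨0, T, htop, rfl⟩
    · simp only [IsChainTop, hT, true_and, not_forall, not_not] at htop
      obtain ⟨H, hH, hc⟩ := htop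
      obtain ⟨i, hi⟩ := ih hH (by have := card_of_psi hc; omega)
      exact ⟨i + 1, hi.psi hc⟩

/-- A set not at even distance from the top is the image of a set at even distance. -/
theorem exists_psi_of_not_evenInChain (hT : T ⊆ A) (h : ¬ EvenInChain A T) :
    ∃ H, psi H = some T ∧ H ⊆ A ∧ EvenInChain A H := by
  obtain ⟨i, S, hS, hi⟩ := exists_chainDist hT
  rcases Nat.even_or_odd' i with ⟨m, rfl | rfl⟩
  · exact absurd ⟨m, S, hS, hi⟩ h
  · rw [psiIter_succ, Option.bind_eq_some_iff] at hi
    obtain ⟨U, hU, hUT⟩ := hi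
    exact ⟨U, hUT, (psiIter_subset hU).trans hS.1, m, S, hS, hU⟩

theorem evenInChain_iff_of_psi (hH : H ⊆ A) (hT : psi H = some T) :
    EvenInChain A T ↔ ¬ EvenInChain A H := by
  obtain ⟨i, hi⟩ := exists_chainDist hH
  constructor
  · rintro ⟨m, hm⟩ ⟨l, hl⟩
    have := hm.unique (hl.psi hT)
    omega
  · intro h
    rcases Nat.even_or_odd' i with ⟨m, rfl | rfl⟩
    · exact absurd ⟨m, hi⟩ h
    · exact ⟨m + 1, hi.psi hT⟩

theorem LastMax.psi_insert {p : Fin n} (h : LastMax T p) : psi (insert p T) = some T :=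
  psi_eq_some_iff.2 ⟨p, h, rfl⟩

theorem IsChainTop.of_lastMax {p : ℕ} (hT : T ⊆ A) (hp : LastMax T p)
    (h : ∀ q : Fin n, (q : ℕ) = p → q ∉ A) : IsChainTop A T := by
  refine ⟨hT, fun H hH hc => ?_⟩
  obtain ⟨q, hq, rfl⟩ := psi_eq_some_iff.1 hc
  exact h q (hq.unique hp) (hH (Finset.mem_insert_self _ _))

/-- If the paths of `L` and `L \ {y}` have the same last maximum, and it lies after `y`, then the
same elements are added in the `psi`-chains through the two sets. -/
theorem evenInChain_erase_iff {L : Finset (Fin n)} {y : Fin n} {p : ℕ} (hy : y ∈ L) (hL : L ⊆ A)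
    (h : LastMax L p) (h' : LastMax (L.erase y) p) (hyp : (y : ℕ) < p) :
    EvenInChain A L ↔ EvenInChain A (L.erase y) := by
  induction hm : A.card - L.card generalizing L p with
  | zero =>
    have hLA : L = A := Finset.eq_of_subset_of_card_le hL (by omega)
    have hq : ∀ q : Fin n, (q : ℕ) = p → q ∉ A := by
      rintro q rfl hq
      exact h.notMem (hLA ▸ hq)
    exact iff_of_true ⟨0, L, .of_lastMax hL h hq, rfl⟩
      ⟨0, _, .of_lastMax ((Finset.erase_subset _ _).trans hL) h' hq, rfl⟩
  | succ m ih =>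
    by_cases hq : ∀ q : Fin n, (q : ℕ) = p → q ∉ A
    · exact iff_of_true ⟨0, L, .of_lastMax hL h hq, rfl⟩
        ⟨0, _, .of_lastMax ((Finset.erase_subset _ _).trans hL) h' hq, rfl⟩
    push Not at hq
    obtain ⟨q, rfl, hqA⟩ := hq
    have hqL := h.notMem
    have hqy : q ≠ y := fun hc => hqL (hc ▸ hy)
    have e : insert q (L.erase y) = (insert q L).erase y :=
      Finset.erase_insert_of_ne hqy |>.symm
    have hsub : insert q L ⊆ A := Finset.insert_subset hqA hL
    have hsub' : insert q (L.erase y) ⊆ A :=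
      Finset.insert_subset hqA ((Finset.erase_subset _ _).trans hL)
    rw [evenInChain_iff_of_psi hsub h.psi_insert, evenInChain_iff_of_psi hsub' h'.psi_insert, e]
    obtain ⟨r, hr⟩ := exists_lastMax (insert q L)
    have r1 := rho_insert hqL
    have r2 := rho_insert h'.notMem
    have r3 := rho_insert (Finset.notMem_erase y L)
    rw [Finset.insert_erase hy] at r3
    have hqr : (q : ℕ) < r := by
      by_contra hc
      have h1 := (hr.2 (q + 1) (by omega)).2 (by omega)
      rw [r1, r1, if_pos le_rfl, if_neg (by omega), rho_succ_of_notMem hqL] at h1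
      have := (h.2 r hr.1).1
      omega
    refine not_congr (ih (Finset.mem_insert_of_mem hy) hsub hr ?_ (by omega) ?_)
    · rw [← e]
      refine ⟨hr.1, fun g hg => ?_⟩
      have h1 := hr.2 g hg
      have h2 := h'.2 g hg
      have h3 := (hr.2 (q + 1) (by omega)).1
      have h4 := rho_succ_of_notMem hqL
      have h5 := r3 g
      have h6 := r3 r
      have h7 := r3 q
      rw [if_pos (by omega)] at h6 h7
      rw [r1, r1, if_pos le_rfl, if_pos (by omega)] at h3
      rw [r1, r1, if_pos (by omega : (q : ℕ) + 1 ≤ r)] at h1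
      rw [r2, r2, if_pos (by omega : (q : ℕ) + 1 ≤ r)]
      split_ifs at h1 h5 ⊢ <;> omega
    · rw [Finset.card_insert_of_notMem hqL]
      omega

/-- Acyclicity of the matching `psi` between the sets at even distance from the top and their
images. -/
theorem lexLT_of_psi_subset {H' : Finset (Fin n)} (hH : H ⊆ A) (hH' : H' ⊆ A)
    (e : EvenInChain A H) (e' : EvenInChain A H') (hT : psi H' = some T) (hTH : T ⊆ H)
    (hc : H.card = H'.card) (hne : H' ≠ H) : LexLT H' H := by
  obtain ⟨y, hy, rfl⟩ := exists_eq_erase hTH (by rw [hc, card_of_psi hT])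
  obtain ⟨p, hp, rfl⟩ := psi_eq_some_iff.1 hT
  rcases lt_trichotomy p y with h | rfl | h
  · exact lexLT_insert_erase (fun hc => hp.notMem (Finset.mem_erase.2 ⟨h.ne, hc⟩)) h
  · exact absurd (Finset.insert_erase hy) hne
  -- here the last maximum of `T` lies after the removed element, so it is also that of `H`
  · exfalso
    have hyp : (y : ℕ) < p := h
    have hL : LastMax H p := by
      refine ⟨hp.1, fun g hg => ?_⟩
      have h1 := hp.2 g hg
      have r := rho_insert (Finset.notMem_erase y H)
      rw [Finset.insert_erase hy] at r
      rw [r, r, if_pos (by omega : (y : ℕ) + 1 ≤ p)]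
      split_ifs <;> omega
    exact (evenInChain_iff_of_psi hH' hT).1 ((evenInChain_erase_iff hy hH hL hp hyp).1 e) e'

end Chains

/-! ### Faces at even distance span the chains modulo boundaries -/

section SimplicialChains

variable {n : ℕ} {K : Type*} [Field K]

/-- The boundary operator on the chains of the full simplex with vertex set `Fin n`, a chain being
given by its coefficients; `ε i U` is the incidence number of the faces `insert i U` and `U`. -/
def faceBoundary (ε : Fin n → Finset (Fin n) → K) :
    (Finset (Fin n) → K) →ₗ[K] (Finset (Fin n) → K) where
  toFun f U := ∑ i ∈ Uᶜ, ε i U * f (insert i U)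
  map_add' f g := by
    ext U
    simp [mul_add, Finset.sum_add_distrib]
  map_smul' c f := by
    ext U
    simp [Finset.mul_sum, mul_left_comm]

/-- The chains that involve only faces satisfying `P`. -/
def chainsOn (K : Type*) [Field K] (P : Finset (Fin n) → Prop) :
    Submodule K (Finset (Fin n) → K) where
  carrier := {f | ∀ T, ¬ P T → f T = 0}
  add_mem' hf hg T hT := by simp [hf T hT, hg T hT]
  zero_mem' T _ := rfl
  smul_mem' c f hf T hT := by simp [hf T hT]

theorem single_mem_chainsOn {P : Finset (Fin n) → Prop} {T : Finset (Fin n)} (h : P T) (c : K) :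
    Pi.single T c ∈ chainsOn K P := fun U hU => by
  rw [Pi.single_eq_of_ne]
  rintro rfl
  exact hU h

theorem mem_of_single_mem {W : Submodule K (Finset (Fin n) → K)} {f : Finset (Fin n) → K}
    (h : ∀ T, f T ≠ 0 → Pi.single T (1 : K) ∈ W) : f ∈ W := by
  have : f = ∑ T, f T • Pi.single T (1 : K) := by
    ext U
    simp [Finset.sum_apply, Pi.single_apply]
  rw [this]
  refine W.sum_mem fun T _ => ?_
  by_cases hT : f T = 0
  · simp [hT]
  · exact W.smul_mem _ (h T hT)

theorem faceBoundary_apply (ε : Fin n → Finset (Fin n) → K) (f : Finset (Fin n) → K)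
    (U : Finset (Fin n)) : faceBoundary ε f U = ∑ i ∈ Uᶜ, ε i U * f (insert i U) := rfl

/-- The `k`-element faces at even distance from the top of their chain. -/
def EvenFace (A : Finset (Fin n)) (k : ℕ) (T : Finset (Fin n)) : Prop :=
  T ⊆ A ∧ EvenInChain A T ∧ T.card = k

/-- The faces at even distance span all chains modulo boundaries: if `T = psi H`, then the boundary
of `H` expresses `T` by other faces, and acyclicity makes this process terminate. -/
theorem chainsOn_le_sup (ε : Fin n → Finset (Fin n) → K) (hε : ∀ i U, i ∉ U → ε i U ≠ 0)
    (A : Finset (Fin n)) (k : ℕ) :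
    chainsOn K (fun T => T ⊆ A ∧ T.card = k) ≤ chainsOn K (EvenFace A k) ⊔
      (chainsOn K fun T => T ⊆ A ∧ T.card = k + 1).map (faceBoundary ε) := by
  set W := chainsOn K (EvenFace A k) ⊔
      (chainsOn K fun T => T ⊆ A ∧ T.card = k + 1).map (faceBoundary ε)
  have key : ∀ H T, psi H = some T → H ⊆ A → EvenInChain A H → H.card = k + 1 →
      Pi.single T (1 : K) ∈ W := by
    intro H
    induction H using wellFounded_lexLT.induction with
    | _ H ih =>
    intro T hT hHA he hc
    set g := faceBoundary ε (Pi.single H 1)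
    have hg : g ∈ W := Submodule.mem_sup_right
      ⟨_, single_mem_chainsOn ⟨hHA, hc⟩ 1, rfl⟩
    obtain ⟨p, hp, hHp⟩ := psi_eq_some_iff.1 hT
    have hgT : g T = ε p T := by
      simp only [g, faceBoundary_apply]
      rw [Finset.sum_eq_single p]
      · rw [← hHp, Pi.single_eq_same, mul_one]
      · intro i hi hip
        rw [Pi.single_eq_of_ne, mul_zero]
        intro h
        rw [hHp] at h
        have : i ∈ insert p T := h ▸ Finset.mem_insert_self _ _
        rcases Finset.mem_insert.1 this with h | h
        · exact hip h
        · exact Finset.mem_compl.1 hi h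
      · intro h
        exact absurd hp.notMem (by simpa using h)
    -- the other facets of `H` are at even distance, or images of earlier faces
    have hrest : g - g T • Pi.single T 1 ∈ W := by
      refine mem_of_single_mem fun U hU => ?_
      have hUT : U ≠ T := by
        rintro rfl
        simp at hU
      have hgU : g U ≠ 0 := by simpa [Pi.single_eq_of_ne hUT] using hU
      obtain ⟨i, hi, hne⟩ := Finset.exists_ne_zero_of_sum_ne_zero hgU
      have hUH : insert i U = H := by
        by_contra hc
        simp [Pi.single_eq_of_ne hc] at hne
      have hiU : i ∉ U := Finset.mem_compl.1 hi
      have hUH' : U ⊆ H := hUH ▸ Finset.subset_insert _ _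
      have hUc : U.card = k := by
        have := Finset.card_insert_of_notMem hiU
        rw [hUH] at this
        omega
      by_cases heU : EvenInChain A U
      · exact Submodule.mem_sup_left (single_mem_chainsOn ⟨hUH'.trans hHA, heU, hUc⟩ 1)
      · obtain ⟨H', hH', hH'A, he'⟩ := exists_psi_of_not_evenInChain (hUH'.trans hHA) heU
        have hc' : H'.card = k + 1 := by rw [card_of_psi hH', hUc]
        refine ih H' (lexLT_of_psi_subset hHA hH'A he he' hH' hUH' (by omega) ?_) U hH' hH'A he' hc'
        rintro rfl
        exact hUT (Option.some_injective _ (hH'.symm.trans hT))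
    have h1 : g T • Pi.single T (1 : K) ∈ W := by
      have := W.sub_mem hg hrest
      rwa [sub_sub_cancel] at this
    have h2 := W.smul_mem (g T)⁻¹ h1
    rwa [smul_smul, inv_mul_cancel₀ (hgT ▸ hε p T hp.notMem), one_smul] at h2
  intro f hf
  refine mem_of_single_mem fun T hT => ?_
  obtain ⟨hTA, hTk⟩ : T ⊆ A ∧ T.card = k := by
    by_contra hc
    exact hT (hf T hc)
  by_cases he : EvenInChain A T
  · exact Submodule.mem_sup_left (single_mem_chainsOn ⟨hTA, he, hTk⟩ 1)
  · obtain ⟨H, hH, hHA, he'⟩ := exists_psi_of_not_evenInChain hTA he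
    exact key H T hH hHA he' (by rw [card_of_psi hH, hTk])

/-- The faces at even distance are linearly independent modulo boundaries. -/
theorem eq_zero_of_eq_faceBoundary (ε : Fin n → Finset (Fin n) → K)
    (hε : ∀ i U, i ∉ U → ε i U ≠ 0) (hεε : ∀ f, faceBoundary ε (faceBoundary ε f) = 0)
    {A : Finset (Fin n)} {k : ℕ} (hk : n < 2 * (k + 1)) {g u : Finset (Fin n) → K}
    (hg : g ∈ chainsOn K (EvenFace A k)) (hu : u ∈ chainsOn K fun T => T ⊆ A ∧ T.card = k + 1)
    (hgu : g = faceBoundary ε u) : g = 0 := by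
  obtain ⟨g', hg', v, ⟨w, -, rfl⟩, rfl⟩ :=
    Submodule.mem_sup.1 (chainsOn_le_sup ε hε A (k + 1) hu)
  rw [map_add, hεε, add_zero] at hgu
  suffices g' = 0 by rw [hgu, this, map_zero]
  by_contra hne
  obtain ⟨H₀, hH₀⟩ := Function.ne_iff.1 hne
  -- for a lexicographically last face `H` of `g'`, the coefficient of `psi H` in the boundary of `g'`
  -- comes from `H` alone, whereas `psi H` is at odd distance
  obtain ⟨H, hH, hmax⟩ := wellFounded_swap_lexLT.has_min {H | g' H ≠ 0} ⟨H₀, hH₀⟩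
  have hface : ∀ {H}, g' H ≠ 0 → EvenFace A (k + 1) H := fun {H} h => by
    by_contra hc
    exact h (hg' H hc)
  obtain ⟨hHA, he, hc⟩ := hface hH
  obtain ⟨T, hT⟩ := exists_psi_eq_some (H := H) (by omega)
  obtain ⟨p, hp, hHp⟩ := psi_eq_some_iff.1 hT
  have hgT : g T = ε p T * g' H := by
    rw [hgu, faceBoundary_apply, Finset.sum_eq_single p, hHp]
    · intro i hi hip
      by_contra hne
      have hgi : g' (insert i T) ≠ 0 := right_ne_zero_of_mul hne
      obtain ⟨hiA, hei, hci⟩ := hface hgi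
      refine hmax _ hgi (lexLT_of_psi_subset hiA hHA hei he hT (Finset.subset_insert _ _)
        (by omega) fun h => ?_)
      rw [hHp] at h
      have : i ∈ insert p T := h ▸ Finset.mem_insert_self _ _
      rcases Finset.mem_insert.1 this with h | h
      · exact hip h
      · exact Finset.mem_compl.1 hi h
    · intro h
      exact absurd hp.notMem (by simpa using h)
  have hTe : EvenFace A k T := by
    by_contra hc
    exact mul_ne_zero (hε p T hp.notMem) hH (hgT ▸ hg T hc)
  exact (evenInChain_iff_of_psi hHA hT).1 hTe.2.1 he

end SimplicialChains

/-! ### The Koszul complex in coordinates -/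

section Koszul

open MvPolynomial

variable (K : Type*) [Field K] (n : ℕ)

/-- The exterior algebra of `R^n`, for `R = K[X_1, …, X_n]`. -/
abbrev KoszulAlgebra : Type _ :=
  ExteriorAlgebra (MvPolynomial (Fin n) K) (Fin n → MvPolynomial (Fin n) K)

/-- The basis of the exterior algebra of `R^n` consisting of the exterior products `e_T` of the
standard basis vectors. -/
noncomputable def wedgeBasis :
    Module.Basis (Finset (Fin n)) (MvPolynomial (Fin n) K) (KoszulAlgebra K n) :=
  (Pi.basisFun (MvPolynomial (Fin n) K) (Fin n)).ExteriorAlgebra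

/-- The standard basis vector `e_i`, as an element of the exterior algebra. -/
noncomputable def wedgeGen (i : Fin n) : KoszulAlgebra K n :=
  ExteriorAlgebra.ι (MvPolynomial (Fin n) K) (Pi.single i 1)

/-- The Koszul differential on the whole exterior algebra. -/
noncomputable def koszulDiff : KoszulAlgebra K n →ₗ[MvPolynomial (Fin n) K] KoszulAlgebra K n :=
  CliffordAlgebra.contractLeft
    (Q := (0 : QuadraticForm (MvPolynomial (Fin n) K) (Fin n → MvPolynomial (Fin n) K)))
    (Fintype.linearCombination (MvPolynomial (Fin n) K) MvPolynomial.X)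

/-- The augmented Koszul differential on the whole exterior algebra. -/
noncomputable def augDiff : KoszulAlgebra K n →ₗ[MvPolynomial (Fin n) K] KoszulTotal K n :=
  LinearMap.prod (koszulDiff K n)
    ((maxHomIdeal K n).mkQ ∘ₗ ExteriorAlgebra.algebraMapInv.toLinearMap)

/-- The sign in `e_i ∧ e_U = ± e_{U ∪ {i}}`, for `i ∉ U`. -/
noncomputable def wedgeSign {n : ℕ} (i : Fin n) (U : Finset (Fin n)) : ℤˣ :=
  if h : Disjoint ({i} : Finset (Fin n)) U then
    Equiv.Perm.sign (Set.powersetCard.permOfDisjoint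
      (s := (⟨{i}, rfl⟩ : Set.powersetCard (Fin n) 1))
      (t := (⟨U, rfl⟩ : Set.powersetCard (Fin n) U.card)) h)
  else 1

variable {K n}

theorem koszulBoundary_apply (k : ℕ)
    (w : ⋀[MvPolynomial (Fin n) K]^k (Fin n → MvPolynomial (Fin n) K)) :
    koszulBoundary K n k w = augDiff K n w := rfl

theorem augDiff_apply (x : KoszulAlgebra K n) :
    augDiff K n x = (koszulDiff K n x,
      (maxHomIdeal K n).mkQ (ExteriorAlgebra.algebraMapInv x)) := rfl

@[elab_as_elim]
theorem koszulAlgebra_induction {P : KoszulAlgebra K n → Prop} (x : KoszulAlgebra K n)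
    (zero : P 0) (add : ∀ x y, P x → P y → P (x + y))
    (smul : ∀ (c : MvPolynomial (Fin n) K) x, P x → P (c • x))
    (basis : ∀ T, P (wedgeBasis K n T)) : P x := by
  rw [← (wedgeBasis K n).sum_repr x]
  exact Finset.sum_induction _ P add zero fun T _ => smul _ _ (basis T)

theorem wedgeBasis_eq (T : Finset (Fin n)) {k : ℕ} (h : T.card = k) :
    wedgeBasis K n T = ExteriorAlgebra.ιMulti_family (MvPolynomial (Fin n) K) k
      (fun i => (Pi.single i 1 : Fin n → MvPolynomial (Fin n) K)) ⟨T, h⟩ := by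
  have : (fun i => (Pi.single i 1 : Fin n → MvPolynomial (Fin n) K)) =
      Pi.basisFun (MvPolynomial (Fin n) K) (Fin n) := by
    ext1 i
    simp
  rw [this]
  exact ExteriorAlgebra.basis_apply_ofCard _ h

theorem wedgeBasis_empty : wedgeBasis K n ∅ = 1 := by
  rw [wedgeBasis_eq ∅ rfl]
  exact ExteriorAlgebra.ιMulti_zero_apply _

theorem wedgeBasis_singleton (i : Fin n) : wedgeBasis K n {i} = wedgeGen K n i := by
  rw [wedgeBasis_eq {i} (Finset.card_singleton i), wedgeGen]
  have : (Set.powersetCard.ofFinEmbEquiv.symm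
      (⟨{i}, Finset.card_singleton i⟩ : Set.powersetCard (Fin n) 1)) 0 = i := by
    rw [Set.powersetCard.ofFinEmbEquiv_symm_apply]
    exact Finset.mem_singleton.1 (Finset.orderEmbOfFin_mem _ _ _)
  simp [ExteriorAlgebra.ιMulti_family, this]

theorem wedgeGen_mul_wedgeBasis_of_mem {i : Fin n} {U : Finset (Fin n)} (h : i ∈ U) :
    wedgeGen K n i * wedgeBasis K n U = 0 := by
  rw [← wedgeBasis_singleton]
  exact ExteriorAlgebra.basis_mul_of_not_disjoint _
    (⟨{i}, rfl⟩ : Set.powersetCard (Fin n) 1) (⟨U, rfl⟩ : Set.powersetCard (Fin n) U.card)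
    (by simpa using h)

theorem wedgeGen_mul_wedgeBasis {i : Fin n} {U : Finset (Fin n)} (h : i ∉ U) :
    wedgeGen K n i * wedgeBasis K n U =
      ((wedgeSign i U : ℤ) : MvPolynomial (Fin n) K) • wedgeBasis K n (insert i U) := by
  have hd : Disjoint ({i} : Finset (Fin n)) U := by simpa using h
  rw [← wedgeBasis_singleton, wedgeSign, dif_pos hd, Int.cast_smul_eq_zsmul]
  refine (ExteriorAlgebra.basis_mul_of_disjoint _
    (⟨{i}, rfl⟩ : Set.powersetCard (Fin n) 1)
    (⟨U, rfl⟩ : Set.powersetCard (Fin n) U.card) hd).trans ?_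
  rw [Units.smul_def]
  congr 2
  ext j
  simp [Set.powersetCard.disjUnion]

theorem repr_wedgeGen_mul (i : Fin n) (x : KoszulAlgebra K n) (U : Finset (Fin n)) :
    (wedgeBasis K n).repr (wedgeGen K n i * x) U =
      if i ∈ U then ((wedgeSign i (U.erase i) : ℤ) : MvPolynomial (Fin n) K) *
        (wedgeBasis K n).repr x (U.erase i) else 0 := by
  induction x using koszulAlgebra_induction with
  | zero => simp
  | add x y hx hy =>
    rw [mul_add, map_add, Finsupp.add_apply, hx, hy, map_add, Finsupp.add_apply]
    split_ifs
    · ring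
    · simp
  | smul c x hx =>
    rw [mul_smul_comm, map_smul, Finsupp.smul_apply, hx, map_smul, Finsupp.smul_apply]
    split_ifs
    · simp only [smul_eq_mul]; ring
    · simp
  | basis T =>
    by_cases hT : i ∈ T
    · rw [wedgeGen_mul_wedgeBasis_of_mem hT, map_zero, Finsupp.zero_apply]
      split_ifs with hU
      · rw [Module.Basis.repr_self, Finsupp.single_eq_of_ne, mul_zero]
        rintro rfl
        simp at hT
      · rfl
    · rw [wedgeGen_mul_wedgeBasis hT, map_smul, Finsupp.smul_apply, Module.Basis.repr_self,
        Module.Basis.repr_self, smul_eq_mul]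
      by_cases hU : insert i T = U
      · subst hU
        simp [hT]
      · rw [Finsupp.single_eq_of_ne (Ne.symm hU), mul_zero]
        split_ifs with hi
        · rw [Finsupp.single_eq_of_ne, mul_zero]
          rintro rfl
          exact hU (Finset.insert_erase hi)
        · rfl

theorem koszulDiff_wedgeGen_mul (i : Fin n) (x : KoszulAlgebra K n) :
    koszulDiff K n (wedgeGen K n i * x) =
      (X i : MvPolynomial (Fin n) K) • x - wedgeGen K n i * koszulDiff K n x := by
  refine (CliffordAlgebra.contractLeft_ι_mul _ _ _).trans ?_
  rw [Fintype.linearCombination_apply]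
  simp [Pi.single_apply]
  rfl

theorem koszulDiff_koszulDiff (x : KoszulAlgebra K n) : koszulDiff K n (koszulDiff K n x) = 0 :=
  CliffordAlgebra.contractLeft_contractLeft _ _

theorem koszulDiff_one : koszulDiff K n 1 = 0 := CliffordAlgebra.contractLeft_one _ _

theorem wedgeSign_smul_smul {i : Fin n} {U : Finset (Fin n)} (x : KoszulAlgebra K n) :
    ((wedgeSign i U : ℤ) : MvPolynomial (Fin n) K) •
      ((wedgeSign i U : ℤ) : MvPolynomial (Fin n) K) • x = x := by
  rw [smul_smul, ← Int.cast_mul, Int.units_coe_mul_self, Int.cast_one, one_smul]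

theorem wedgeBasis_insert {i : Fin n} {U : Finset (Fin n)} (h : i ∉ U) :
    wedgeBasis K n (insert i U) = ((wedgeSign i U : ℤ) : MvPolynomial (Fin n) K) •
      (wedgeGen K n i * wedgeBasis K n U) := by
  rw [wedgeGen_mul_wedgeBasis h, wedgeSign_smul_smul]

theorem koszulDiff_wedgeBasis_insert {i : Fin n} {U : Finset (Fin n)} (h : i ∉ U) :
    koszulDiff K n (wedgeBasis K n (insert i U)) =
      ((wedgeSign i U : ℤ) : MvPolynomial (Fin n) K) •
        ((X i : MvPolynomial (Fin n) K) • wedgeBasis K n U -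
          wedgeGen K n i * koszulDiff K n (wedgeBasis K n U)) := by
  rw [wedgeBasis_insert h, map_smul, koszulDiff_wedgeGen_mul]

/-- The differential of `e_T` involves only the `e_U` with `U = T \ {i}`. -/
theorem exists_eq_insert_of_repr_ne_zero {T U : Finset (Fin n)}
    (h : (wedgeBasis K n).repr (koszulDiff K n (wedgeBasis K n T)) U ≠ 0) :
    ∃ i ∉ U, T = insert i U := by
  induction T using Finset.induction_on generalizing U with
  | empty => simp [wedgeBasis_empty, koszulDiff_one] at h
  | insert j V hj ih =>
    rw [koszulDiff_wedgeBasis_insert hj, map_smul, map_sub, map_smul, Finsupp.smul_apply,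
      Finsupp.sub_apply, Finsupp.smul_apply, repr_wedgeGen_mul, Module.Basis.repr_self] at h
    by_cases hU : U = V
    · exact ⟨j, hU ▸ hj, by rw [hU]⟩
    · rw [Finsupp.single_eq_of_ne hU, smul_zero, zero_sub] at h
      split_ifs at h with hjU
      · obtain ⟨i, hi, hV⟩ := ih (U := U.erase j) fun h0 => h (by rw [h0]; simp)
        have hij : i ≠ j := by
          rintro rfl
          exact hj (hV ▸ Finset.mem_insert_self _ _)
        refine ⟨i, fun hc => hi (Finset.mem_erase.2 ⟨hij, hc⟩), ?_⟩
        rw [hV, Finset.insert_comm, Finset.insert_erase hjU]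
      · simp at h

/-- The Koszul differential in coordinates. -/
theorem repr_koszulDiff (x : KoszulAlgebra K n) (U : Finset (Fin n)) :
    (wedgeBasis K n).repr (koszulDiff K n x) U =
      ∑ i ∈ Uᶜ, ((wedgeSign i U : ℤ) : MvPolynomial (Fin n) K) *
        (X i * (wedgeBasis K n).repr x (insert i U)) := by
  induction x using koszulAlgebra_induction with
  | zero => simp
  | add x y hx hy =>
    rw [map_add, map_add, Finsupp.add_apply, hx, hy, ← Finset.sum_add_distrib]
    refine Finset.sum_congr rfl fun i _ => ?_
    rw [map_add, Finsupp.add_apply]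
    ring
  | smul c x hx =>
    rw [map_smul, map_smul, Finsupp.smul_apply, hx, Finset.smul_sum]
    refine Finset.sum_congr rfl fun i _ => ?_
    rw [map_smul, Finsupp.smul_apply, smul_eq_mul, smul_eq_mul]
    ring
  | basis T =>
    rw [Module.Basis.repr_self]
    by_cases hT : ∃ i ∉ U, T = insert i U
    · obtain ⟨i, hi, rfl⟩ := hT
      rw [Finset.sum_eq_single i, koszulDiff_wedgeBasis_insert hi]
      · simp [repr_wedgeGen_mul, hi]
      · intro j hj hji
        rw [Finsupp.single_eq_of_ne, mul_zero, mul_zero]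
        intro hc
        have : j ∈ insert i U := hc ▸ Finset.mem_insert_self _ _
        rcases Finset.mem_insert.1 this with h | h
        · exact hji h
        · exact Finset.mem_compl.1 hj h
      · intro h
        exact absurd hi (by simpa using h)
    · rw [Finset.sum_eq_zero]
      · by_contra hc
        exact hT (exists_eq_insert_of_repr_ne_zero hc)
      · intro i hi
        rw [Finsupp.single_eq_of_ne, mul_zero, mul_zero]
        rintro rfl
        exact hT ⟨i, Finset.mem_compl.1 hi, rfl⟩

theorem algebraMapInv_eq_repr (x : KoszulAlgebra K n) :
    ExteriorAlgebra.algebraMapInv x = (wedgeBasis K n).repr x ∅ := by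
  induction x using koszulAlgebra_induction with
  | zero => simp
  | add x y hx hy => rw [map_add, hx, hy, map_add, Finsupp.add_apply]
  | smul c x hx => rw [map_smul, hx, map_smul, Finsupp.smul_apply]
  | basis T =>
    rw [Module.Basis.repr_self]
    rcases T.eq_empty_or_nonempty with rfl | ⟨i, hi⟩
    · rw [wedgeBasis_empty, map_one, Finsupp.single_eq_same]
    · rw [Finsupp.single_eq_of_ne (Finset.ne_empty_of_mem hi).symm, ← Finset.insert_erase hi,
        wedgeBasis_insert (Finset.notMem_erase _ _), map_smul, map_mul]
      simp [wedgeGen, ExteriorAlgebra.algebraMapInv]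

theorem X_mem_maxHomIdeal (i : Fin n) : (X i : MvPolynomial (Fin n) K) ∈ maxHomIdeal K n :=
  Ideal.subset_span ⟨i, rfl⟩

theorem constantCoeff_of_mem_maxHomIdeal {p : MvPolynomial (Fin n) K}
    (h : p ∈ maxHomIdeal K n) : constantCoeff p = 0 := by
  have : maxHomIdeal K n ≤ RingHom.ker (constantCoeff (σ := Fin n) (R := K)) := by
    refine Ideal.span_le.2 ?_
    rintro _ ⟨i, rfl⟩
    simp
  exact this h

theorem augDiff_koszulDiff (x : KoszulAlgebra K n) : augDiff K n (koszulDiff K n x) = 0 := by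
  rw [augDiff_apply, koszulDiff_koszulDiff, algebraMapInv_eq_repr, repr_koszulDiff]
  refine Prod.ext rfl ?_
  refine (Submodule.Quotient.mk_eq_zero _).2 (Submodule.sum_mem _ fun i _ => ?_)
  exact Ideal.mul_mem_left _ _ (Ideal.mul_mem_right _ _ (X_mem_maxHomIdeal i))

theorem wedgeBasis_mem {T : Finset (Fin n)} {k : ℕ} (h : T.card = k) :
    wedgeBasis K n T ∈ ⋀[MvPolynomial (Fin n) K]^k (Fin n → MvPolynomial (Fin n) K) := by
  rw [wedgeBasis_eq T h]
  exact ExteriorAlgebra.ιMulti_range _ _ ⟨_, rfl⟩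

theorem mem_exteriorPower_iff {k : ℕ} {x : KoszulAlgebra K n} :
    x ∈ ⋀[MvPolynomial (Fin n) K]^k (Fin n → MvPolynomial (Fin n) K) ↔
      ∀ T : Finset (Fin n), T.card ≠ k → (wedgeBasis K n).repr x T = 0 := by
  constructor
  · intro hx T hT
    have hs : Submodule.span (MvPolynomial (Fin n) K) (Set.range fun i : Fin n =>
        (Pi.single i 1 : Fin n → MvPolynomial (Fin n) K)) = ⊤ := by
      have := (Pi.basisFun (MvPolynomial (Fin n) K) (Fin n)).span_eq
      convert this using 3
      ext1 i
      simp
    rw [← exteriorPower.ιMulti_family_span_fixedDegree_of_span _ hs] at hx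
    induction hx using Submodule.span_induction with
    | mem x hx =>
      obtain ⟨S, rfl⟩ := hx
      obtain ⟨S, hS⟩ := S
      rw [← wedgeBasis_eq S hS, Module.Basis.repr_self, Finsupp.single_eq_of_ne]
      rintro rfl
      exact hT hS
    | zero => simp
    | add x y _ _ hx hy => rw [map_add, Finsupp.add_apply, hx, hy, add_zero]
    | smul c x _ hx => rw [map_smul, Finsupp.smul_apply, hx, smul_zero]
  · intro h
    rw [← (wedgeBasis K n).sum_repr x]
    refine Submodule.sum_mem _ fun T _ => ?_
    by_cases hT : T.card = k
    · exact Submodule.smul_mem _ _ (wedgeBasis_mem hT)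
    · rw [h T hT, zero_smul]
      exact Submodule.zero_mem _

theorem koszulGen_coe (k : ℕ) (G : Set.powersetCard (Fin n) k) :
    (koszulGen K n k G : KoszulTotal K n) = augDiff K n (wedgeBasis K n G) := by
  rw [wedgeBasis_eq (G : Finset (Fin n)) G.2]
  rfl

end Koszul

/-! ### Multigraded components of the Koszul complex -/

section Components

open MvPolynomial

variable {K : Type*} [Field K] {n : ℕ}

/-- The exponent vector of the squarefree monomial with support `T`. -/
noncomputable def faceExp (T : Finset (Fin n)) : Fin n →₀ ℕ :=
  Finsupp.equivFunOnFinite.symm fun i => if i ∈ T then 1 else 0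

theorem faceExp_apply (T : Finset (Fin n)) (i : Fin n) :
    faceExp T i = if i ∈ T then 1 else 0 := rfl

theorem support_faceExp (T : Finset (Fin n)) : (faceExp T).support = T := by
  ext i
  simp [faceExp_apply]

theorem prod_X_eq_monomial (T : Finset (Fin n)) :
    ∏ i ∈ T, (X i : MvPolynomial (Fin n) K) = monomial (faceExp T) 1 := by
  rw [monomial_eq, C_1, one_mul, Finsupp.prod, support_faceExp]
  exact Finset.prod_congr rfl fun i hi => by rw [faceExp_apply, if_pos hi, pow_one]

theorem faceExp_le_iff {T : Finset (Fin n)} {a : Fin n →₀ ℕ} :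
    faceExp T ≤ a ↔ T ⊆ a.support := by
  constructor
  · intro h i hi
    have := h i
    rw [faceExp_apply, if_pos hi] at this
    rw [Finsupp.mem_support_iff]
    omega
  · intro h i
    rw [faceExp_apply]
    split_ifs with hi
    · have := Finsupp.mem_support_iff.1 (h hi)
      omega
    · omega

/-- The component of multidegree `a` of an element of the exterior algebra, as a chain of the
simplex: the coefficient at `T` is that of `X^{a - T} e_T`. -/
noncomputable def component (a : Fin n →₀ ℕ) (x : KoszulAlgebra K n) : Finset (Fin n) → K :=
  fun T => if T ⊆ a.support then coeff (a - faceExp T) ((wedgeBasis K n).repr x T) else 0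

/-- The homogeneous element of multidegree `a` with the given component. -/
noncomputable def ofComponent (a : Fin n →₀ ℕ) (f : Finset (Fin n) → K) : KoszulAlgebra K n :=
  ∑ T ∈ a.support.powerset, monomial (a - faceExp T) (f T) • wedgeBasis K n T

variable (K) in
/-- The incidence numbers of the faces of the simplex that belong to the Koszul complex. -/
noncomputable def incidence (i : Fin n) (U : Finset (Fin n)) : K := ((wedgeSign i U : ℤ) : K)

theorem incidence_ne_zero (i : Fin n) (U : Finset (Fin n)) : incidence K i U ≠ 0 := by
  rw [incidence]
  rcases Int.units_eq_one_or (wedgeSign i U) with h | h <;> simp [h]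

theorem component_zero (a : Fin n →₀ ℕ) : component a (0 : KoszulAlgebra K n) = 0 := by
  ext T
  simp [component]

theorem sub_faceExp_insert {a : Fin n →₀ ℕ} {i : Fin n} {U : Finset (Fin n)} (h : i ∉ U) :
    a - faceExp U - Finsupp.single i 1 = a - faceExp (insert i U) := by
  ext j
  simp only [Finsupp.tsub_apply, faceExp_apply]
  by_cases hj : j = i
  · subst hj
    simp [h]
  · simp [hj]

theorem coeff_X_mul_sub_faceExp {a : Fin n →₀ ℕ} {i : Fin n} {U : Finset (Fin n)} (h : i ∉ U)
    (p : MvPolynomial (Fin n) K) :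
    coeff (a - faceExp U) (X i * p) =
      if i ∈ a.support then coeff (a - faceExp (insert i U)) p else 0 := by
  rw [coeff_X_mul', sub_faceExp_insert h]
  simp [faceExp_apply, h]

/-- Taking components turns the Koszul differential into the boundary of simplicial chains. -/
theorem component_koszulDiff (a : Fin n →₀ ℕ) (x : KoszulAlgebra K n) :
    component a (koszulDiff K n x) = faceBoundary (incidence K) (component a x) := by
  ext U
  rw [faceBoundary_apply, component]
  split_ifs with hU
  · rw [repr_koszulDiff, coeff_sum]
    refine Finset.sum_congr rfl fun i hi => ?_
    rw [← map_intCast (C : K →+* MvPolynomial (Fin n) K), coeff_C_mul, coeff_X_mul_sub_faceExp (Finset.mem_compl.1 hi), incidence,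
      component]
    simp only [Finset.insert_subset_iff, hU, and_true]
  · refine (Finset.sum_eq_zero fun i _ => ?_).symm
    rw [component, if_neg, mul_zero]
    exact fun h => hU ((Finset.subset_insert _ _).trans h)

theorem repr_ofComponent (a : Fin n →₀ ℕ) (f : Finset (Fin n) → K) (T : Finset (Fin n)) :
    (wedgeBasis K n).repr (ofComponent a f) T =
      if T ⊆ a.support then monomial (a - faceExp T) (f T) else 0 := by
  simp only [ofComponent, map_sum, map_smul, Module.Basis.repr_self, Finsupp.coe_finsetSum,
    Finset.sum_apply, Finsupp.smul_apply, Finsupp.single_apply, smul_eq_mul, mul_ite, mul_one,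
    mul_zero, Finset.sum_ite_eq', Finset.mem_powerset]

theorem ofComponent_add (a : Fin n →₀ ℕ) (f g : Finset (Fin n) → K) :
    ofComponent a (f + g) = ofComponent a f + ofComponent a g := by
  simp [ofComponent, add_smul, Finset.sum_add_distrib]

theorem component_ofComponent {a : Fin n →₀ ℕ} {f : Finset (Fin n) → K}
    (hf : f ∈ chainsOn K fun T => T ⊆ a.support) : component a (ofComponent a f) = f := by
  ext T
  rw [component, repr_ofComponent]
  split_ifs with h
  · rw [coeff_monomial, if_pos rfl]
  · exact (hf T h).symm

theorem chainsOn_mono {P Q : Finset (Fin n) → Prop} (h : ∀ T, P T → Q T) :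
    chainsOn K P ≤ chainsOn K Q := fun _ hf T hT => hf T fun hP => hT (h T hP)

theorem faceBoundary_faceBoundary (f : Finset (Fin n) → K) :
    faceBoundary (incidence K) (faceBoundary (incidence K) f) = 0 := by
  have h : component (faceExp Finset.univ) (ofComponent (faceExp Finset.univ) f) = f :=
    component_ofComponent fun T hT => absurd (by simp [support_faceExp]) hT
  rw [← h, ← component_koszulDiff, ← component_koszulDiff, koszulDiff_koszulDiff, component_zero]

theorem koszulDiff_ofComponent {a : Fin n →₀ ℕ} {f : Finset (Fin n) → K}
    (hf : f ∈ chainsOn K fun T => T ⊆ a.support) :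
    koszulDiff K n (ofComponent a f) = ofComponent a (faceBoundary (incidence K) f) := by
  refine (wedgeBasis K n).ext_elem fun U => ?_
  rw [repr_koszulDiff, repr_ofComponent]
  split_ifs with hU
  · rw [faceBoundary_apply, map_sum]
    refine Finset.sum_congr rfl fun i hi => ?_
    have hi' := Finset.mem_compl.1 hi
    rw [repr_ofComponent]
    split_ifs with h
    · have e : Finsupp.single i 1 + (a - faceExp (insert i U)) = a - faceExp U := by
        rw [← sub_faceExp_insert hi']
        refine add_tsub_cancel_of_le ?_
        have : i ∈ a.support := h (Finset.mem_insert_self _ _)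
        rw [Finsupp.mem_support_iff] at this
        simp only [Finsupp.single_le_iff, Finsupp.tsub_apply, faceExp_apply, if_neg hi']
        omega
      rw [X, monomial_mul, one_mul, e, ← map_intCast (C : K →+* MvPolynomial (Fin n) K), C_mul_monomial, incidence]
    · rw [hf _ h]
      simp
  · refine Finset.sum_eq_zero fun i _ => ?_
    rw [repr_ofComponent, if_neg, mul_zero, mul_zero]
    exact fun h => hU ((Finset.subset_insert _ _).trans h)

theorem component_mem_chainsOn {k : ℕ} {w : KoszulAlgebra K n} (a : Fin n →₀ ℕ)
    (hw : w ∈ ⋀[MvPolynomial (Fin n) K]^k (Fin n → MvPolynomial (Fin n) K)) :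
    component a w ∈ chainsOn K fun T => T ⊆ a.support ∧ T.card = k := by
  intro T hT
  rw [component]
  split_ifs with h
  · rw [mem_exteriorPower_iff.1 hw T fun hc => hT ⟨h, hc⟩, coeff_zero]
  · rfl

theorem wedgeGen_mul_mem {k : ℕ} {w : KoszulAlgebra K n} (i : Fin n)
    (hw : w ∈ ⋀[MvPolynomial (Fin n) K]^k (Fin n → MvPolynomial (Fin n) K)) :
    wedgeGen K n i * w ∈
      ⋀[MvPolynomial (Fin n) K]^(k + 1) (Fin n → MvPolynomial (Fin n) K) := by
  rw [mem_exteriorPower_iff] at hw ⊢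
  intro T hT
  rw [repr_wedgeGen_mul]
  split_ifs with h
  · rw [hw, mul_zero]
    have := Finset.card_erase_add_one h
    omega
  · rfl

theorem support_add_single {a : Fin n →₀ ℕ} {v : Fin n} (hv : v ∈ a.support) :
    (a + Finsupp.single v 1).support = a.support := by
  ext j
  simp only [Finsupp.mem_support_iff, Finsupp.add_apply, Finsupp.single_apply] at hv ⊢
  split_ifs with h
  · subst h; omega
  · simp

theorem component_add_single_X_smul (a : Fin n →₀ ℕ) {v : Fin n} (hv : v ∈ a.support)
    (x : KoszulAlgebra K n) :
    component (a + Finsupp.single v 1) ((X v : MvPolynomial (Fin n) K) • x) = component a x := by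
  have hs := support_add_single hv
  ext T
  simp only [component, hs]
  split_ifs with hT
  · rw [map_smul, Finsupp.smul_apply, smul_eq_mul, ← coeff_X_mul (a - faceExp T) v,
      add_comm (Finsupp.single v 1), tsub_add_eq_add_tsub (faceExp_le_iff.2 hT)]
  · rfl

/-- Exactness of the augmented Koszul complex, one multidegree at a time. -/
theorem exists_component_eq_faceBoundary {k : ℕ} {w : KoszulAlgebra K n}
    (hw : w ∈ ⋀[MvPolynomial (Fin n) K]^k (Fin n → MvPolynomial (Fin n) K))
    (h : augDiff K n w = 0) (a : Fin n →₀ ℕ) :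
    ∃ u ∈ chainsOn K fun T => T ⊆ a.support ∧ T.card = k + 1,
      component a w = faceBoundary (incidence K) u := by
  rw [augDiff_apply, Prod.mk_eq_zero] at h
  rcases a.support.eq_empty_or_nonempty with ha | ⟨v, hv⟩
  · refine ⟨0, Submodule.zero_mem _, ?_⟩
    rw [map_zero]
    ext T
    rw [component, ha, Finsupp.support_eq_empty.1 ha]
    split_ifs with hT
    · rw [Finset.subset_empty.1 hT, zero_tsub, ← algebraMapInv_eq_repr]
      exact constantCoeff_of_mem_maxHomIdeal ((Submodule.Quotient.mk_eq_zero _).1 h.2)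
    · rfl
  -- multiplication by `e_v` is a contracting homotopy in the multidegrees that involve `X_v`
  · have hs := support_add_single hv
    have hu := component_mem_chainsOn (a + Finsupp.single v 1) (wedgeGen_mul_mem v hw)
    rw [hs] at hu
    refine ⟨_, hu, ?_⟩
    rw [← component_koszulDiff, koszulDiff_wedgeGen_mul, h.1, mul_zero, sub_zero,
      component_add_single_X_smul a hv]

theorem augDiff_ofComponent_faceBoundary {a : Fin n →₀ ℕ} {f : Finset (Fin n) → K}
    (hf : f ∈ chainsOn K fun T => T ⊆ a.support) :
    augDiff K n (ofComponent a (faceBoundary (incidence K) f)) = 0 := by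
  rw [← koszulDiff_ofComponent hf, augDiff_koszulDiff]

end Components

/-! ### Stanley decompositions as unique representations, and the index set -/

section Stanley

open MvPolynomial

variable {K : Type*} [Field K] {n : ℕ} {M : Type*} [AddCommGroup M] [Module K M]
  [Module (MvPolynomial (Fin n) K) M] [IsScalarTower K (MvPolynomial (Fin n) K) M]

theorem mem_stanleySpace {Z : Finset (Fin n)} {m x : M} :
    x ∈ stanleySpace (K := K) Z m ↔ ∃ p ∈ supported K (Z : Set (Fin n)), p • m = x := by
  simp [stanleySpace]

variable {𝓜 : (Fin n → ℤ) → Submodule K M} {ι : Type*} [Fintype ι] [DecidableEq ι]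
  {Z : ι → Finset (Fin n)} {m : ι → M}

/-- A finite family of homogeneous elements is a Stanley decomposition if every element has a unique
representation `∑ f_i m_i` with `f_i ∈ K[Z_i]`. -/
theorem IsStanleyDecomposition.of_unique_repr (hom : ∀ i, ∃ a, m i ∈ 𝓜 a)
    (uniq : ∀ f : ι → MvPolynomial (Fin n) K, (∀ i, f i ∈ supported K (Z i : Set (Fin n))) →
      ∑ i, f i • m i = 0 → ∀ i, f i = 0)
    (span : ∀ x : M, ∃ f : ι → MvPolynomial (Fin n) K,
      (∀ i, f i ∈ supported K (Z i : Set (Fin n))) ∧ ∑ i, f i • m i = x) :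
    IsStanleyDecomposition 𝓜 Z m where
  homogeneous := hom
  free i f hf h := by
    have := uniq (Pi.single i f) (fun j => ?_) ?_ i
    · simpa using this
    · rcases eq_or_ne j i with rfl | hj
      · simpa using hf
      · rw [Pi.single_eq_of_ne hj]
        exact Subalgebra.zero_mem _
    · rw [Finset.sum_eq_single i]
      · simpa using h
      · intro j _ hj
        rw [Pi.single_eq_of_ne hj, zero_smul]
      · simp
  isInternal := by
    refine DirectSum.isInternal_submodule_of_iSupIndep_of_iSup_eq_top ?_ ?_
    · rw [iSupIndep_iff_finsetSum_eq_zero_imp_eq_zero]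
      intro s v hv hsum
      choose! p hp hpv using fun i (hi : i ∈ s) => mem_stanleySpace.1 (hv i hi)
      have := uniq (fun i => if i ∈ s then p i else 0) (fun i => ?_) ?_
      · intro i hi
        have h1 := this i
        rw [if_pos hi] at h1
        rw [← hpv i hi, h1, zero_smul]
      · split_ifs with hi
        · exact hp i hi
        · exact Subalgebra.zero_mem _
      · rw [← hsum, ← Finset.sum_subset (Finset.subset_univ s)]
        · refine Finset.sum_congr rfl fun i hi => ?_
          rw [if_pos hi, hpv i hi]
        · intro i _ hi
          rw [if_neg hi, zero_smul]
    · refine eq_top_iff.2 fun x _ => ?_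
      obtain ⟨f, hf, rfl⟩ := span x
      exact Submodule.sum_mem _ fun i _ =>
        Submodule.mem_iSup_of_mem i (mem_stanleySpace.2 ⟨f i, hf i, rfl⟩)

theorem IsStanleyDecomposition.exists_repr (h : IsStanleyDecomposition 𝓜 Z m) (x : M) :
    ∃ f : ι → MvPolynomial (Fin n) K, ∑ i, f i • m i = x := by
  have hx : x ∈ ⨆ i, stanleySpace (K := K) (Z i) (m i) := by
    rw [h.isInternal.submodule_iSup_eq_top]
    exact Submodule.mem_top
  rw [Submodule.mem_iSup_iff_exists_finsupp] at hx
  obtain ⟨v, hv, rfl⟩ := hx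
  choose p hp hpv using fun i => mem_stanleySpace.1 (hv i)
  exact ⟨p, by rw [Finsupp.sum_fintype _ _ fun _ => rfl]; exact Finset.sum_congr rfl fun i _ => hpv i⟩

theorem IsStanleyDecomposition.eq_zero_of_sum_eq_zero (h : IsStanleyDecomposition 𝓜 Z m)
    {f : ι → MvPolynomial (Fin n) K} (hf : ∀ i, f i ∈ supported K (Z i : Set (Fin n)))
    (hsum : ∑ i, f i • m i = 0) (i : ι) : f i = 0 := by
  have hind := h.isInternal.submodule_iSupIndep
  rw [iSupIndep_iff_finsetSum_eq_zero_imp_eq_zero] at hind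
  exact h.free i (f i) (hf i) (hind Finset.univ (fun i => f i • m i)
    (fun i _ => mem_stanleySpace.2 ⟨f i, hf i, rfl⟩) hsum i (Finset.mem_univ i))

end Stanley

section KoszulDecomposition

open MvPolynomial

variable {K : Type*} [Field K] {n k : ℕ}

theorem mem_koszulZ {S : Finset (Fin n)} {s : Fin n} :
    s ∈ koszulZ S ↔ psi (insert s S) ≠ some S := by
  simp [koszulZ]

theorem subset_koszulZ (S : Finset (Fin n)) : S ⊆ koszulZ S := fun s hs => by
  rw [mem_koszulZ, Finset.insert_eq_of_mem hs]
  intro h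
  have := card_of_psi h
  omega

/-- The summand `K[Z_S] m_S` lives exactly in those multidegrees in whose support `A` the set `S`
is the top of its chain. -/
theorem isChainTop_iff {A S : Finset (Fin n)} : IsChainTop A S ↔ S ⊆ A ∧ A ⊆ koszulZ S := by
  refine and_congr_right fun hS => ⟨fun h s hs => ?_, fun h H hH hc => ?_⟩
  · exact mem_koszulZ.2 (h _ (Finset.insert_subset hs hS))
  · obtain ⟨p, hp, rfl⟩ := psi_eq_some_iff.1 hc
    exact mem_koszulZ.1 (h (hH (Finset.mem_insert_self _ _))) hc

theorem card_koszulZ_compl_le_one (S : Finset (Fin n)) {s t : Fin n} (hs : s ∉ koszulZ S)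
    (ht : t ∉ koszulZ S) : s = t := by
  rw [mem_koszulZ, not_not] at hs ht
  have hsS : s ∉ S := fun h => by
    have := card_of_psi hs
    rw [Finset.insert_eq_of_mem h] at this
    omega
  have : s ∈ insert t S := psi_injective hs ht ▸ Finset.mem_insert_self _ _
  exact (Finset.mem_insert.1 this).resolve_right hsS

theorem exists_psiIter_eq_powersetCard (hk : n / 2 ≤ k) (S : KoszulIndex n k) :
    ∃ G : Set.powersetCard (Fin n) k, psiIter (S.1.card - k) S.1 = some (G : Finset (Fin n)) := by
  have hS := S.2.1
  obtain ⟨T, hT⟩ := exists_psiIter_eq_some (S := S.1) (S.1.card - k) (by omega)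
  exact ⟨⟨T, by have := card_of_psiIter hT; exact (by omega : T.card = k)⟩, hT⟩

variable {G : KoszulIndex n k → Set.powersetCard (Fin n) k}

theorem evenFace_iff
    (hG : ∀ S : KoszulIndex n k, psiIter (S.1.card - k) S.1 = some (G S : Finset (Fin n)))
    {A T : Finset (Fin n)} :
    EvenFace A k T ↔ ∃ S : KoszulIndex n k, IsChainTop A S.1 ∧ (G S : Finset (Fin n)) = T := by
  constructor
  · rintro ⟨-, ⟨i, S, hS, hi⟩, rfl⟩
    have hc := card_of_psiIter hi
    refine ⟨⟨S, by omega, ⟨i, by omega⟩⟩, hS, Option.some_injective _ ?_⟩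
    rw [← hG, ← hi]
    congr
    exact by simp only; omega
  · rintro ⟨S, hS, rfl⟩
    obtain ⟨i, hi⟩ := S.2.2
    exact ⟨(psiIter_subset (hG S)).trans hS.1, ⟨i, S.1, hS, by rw [← hG, hi, two_mul]⟩, (G S).2⟩

theorem eq_of_coe_eq_of_isChainTop
    (hG : ∀ S : KoszulIndex n k, psiIter (S.1.card - k) S.1 = some (G S : Finset (Fin n)))
    {A : Finset (Fin n)} {S S' : KoszulIndex n k} (hS : IsChainTop A S.1)
    (hS' : IsChainTop A S'.1) (h : (G S : Finset (Fin n)) = G S') : S = S' :=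
  Subtype.ext (psiIter_top_unique hS hS' (hG S) (h ▸ hG S')).2

end KoszulDecomposition

/-! ### The explicit decomposition of `M(n,k)` -/

section KoszulDecomposition

open MvPolynomial

variable {K : Type*} [Field K] {n k : ℕ} {G : KoszulIndex n k → Set.powersetCard (Fin n) k}

/-- The element `∑ f_S X^{S \ G(S)} e_{G(S)}` of the exterior algebra, whose image under the
augmented differential is `∑ f_S m_S`. -/
noncomputable def indexSum (G : KoszulIndex n k → Set.powersetCard (Fin n) k)
    (f : KoszulIndex n k → MvPolynomial (Fin n) K) : KoszulAlgebra K n :=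
  ∑ S, (f S * monomial (faceExp (S.1 \ (G S : Finset (Fin n)))) 1) •
    wedgeBasis K n (G S : Finset (Fin n))

theorem repr_indexSum (f : KoszulIndex n k → MvPolynomial (Fin n) K) (T : Finset (Fin n)) :
    (wedgeBasis K n).repr (indexSum G f) T = ∑ S, if (G S : Finset (Fin n)) = T then
      f S * monomial (faceExp (S.1 \ (G S : Finset (Fin n)))) 1 else 0 := by
  simp only [indexSum, map_sum, map_smul, Module.Basis.repr_self, Finsupp.coe_finsetSum,
    Finset.sum_apply, Finsupp.smul_apply, Finsupp.single_apply, smul_eq_mul, mul_ite, mul_one,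
    mul_zero]

theorem indexSum_mem (f : KoszulIndex n k → MvPolynomial (Fin n) K) :
    indexSum G f ∈ ⋀[MvPolynomial (Fin n) K]^k (Fin n → MvPolynomial (Fin n) K) :=
  Submodule.sum_mem _ fun S _ => Submodule.smul_mem _ _ (wedgeBasis_mem (G S).2)

theorem augDiff_indexSum (f : KoszulIndex n k → MvPolynomial (Fin n) K) :
    augDiff K n (indexSum G f) =
      ((∑ S, f S • ((∏ i ∈ S.1 \ (G S : Finset (Fin n)), (X i : MvPolynomial (Fin n) K)) •
        koszulGen K n k (G S)) : koszulSyzygy K n k) : KoszulTotal K n) := by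
  simp only [indexSum, map_sum, map_smul, Submodule.coe_sum, Submodule.coe_smul, koszulGen_coe,
    mul_smul, prod_X_eq_monomial]

theorem coeff_mul_monomial_faceExp {a : Fin n →₀ ℕ} {S T : Finset (Fin n)} (hTS : T ⊆ S)
    (hT : T ⊆ a.support) (p : MvPolynomial (Fin n) K) :
    coeff (a - faceExp T) (p * monomial (faceExp (S \ T)) 1) =
      if S ⊆ a.support then coeff (a - faceExp S) p else 0 := by
  rw [coeff_mul_monomial', mul_one]
  have h1 : faceExp (S \ T) ≤ a - faceExp T ↔ S ⊆ a.support := by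
    rw [← faceExp_le_iff]
    refine forall_congr' fun i => ?_
    have := faceExp_le_iff.2 hT i
    simp only [Finsupp.tsub_apply, faceExp_apply, Finset.mem_sdiff] at this ⊢
    by_cases hi : i ∈ T
    · simp [hi, hTS hi] at this ⊢
      omega
    · simp [hi]
  have h2 : a - faceExp T - faceExp (S \ T) = a - faceExp S := by
    ext i
    simp only [Finsupp.tsub_apply, faceExp_apply, Finset.mem_sdiff]
    by_cases hi : i ∈ T
    · simp [hi, hTS hi]
    · simp [hi]
  simp only [h1, h2]

theorem isChainTop_of_coeff_ne_zero {a : Fin n →₀ ℕ} {S : Finset (Fin n)}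
    {p : MvPolynomial (Fin n) K} (hp : p ∈ supported K (koszulZ S : Set (Fin n)))
    (hS : S ⊆ a.support) (h : coeff (a - faceExp S) p ≠ 0) : IsChainTop a.support S := by
  refine isChainTop_iff.2 ⟨hS, fun s hs => ?_⟩
  by_cases hsS : s ∈ S
  · exact subset_koszulZ S hsS
  · refine mem_supported.1 hp ((mem_vars_iff_mem_support s).2 ⟨_, mem_support_iff.2 h, ?_⟩)
    simpa [faceExp_apply, hsS] using hs

theorem component_indexSum
    (hG : ∀ S : KoszulIndex n k, psiIter (S.1.card - k) S.1 = some (G S : Finset (Fin n)))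
    {f : KoszulIndex n k → MvPolynomial (Fin n) K}
    (hf : ∀ S, f S ∈ supported K (koszulZ S.1 : Set (Fin n))) (a : Fin n →₀ ℕ)
    (T : Finset (Fin n)) :
    component a (indexSum G f) T = ∑ S : KoszulIndex n k, open Classical in
      if IsChainTop a.support S.1 ∧ (G S : Finset (Fin n)) = T then
        coeff (a - faceExp S.1) (f S) else 0 := by
  classical
  rw [component]
  split_ifs with hT
  · rw [repr_indexSum, coeff_sum]
    refine Finset.sum_congr rfl fun S _ => ?_
    by_cases hS : (G S : Finset (Fin n)) = T
    · subst hS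
      rw [if_pos rfl, coeff_mul_monomial_faceExp (psiIter_subset (hG S)) hT]
      by_cases htop : IsChainTop a.support S.1
      · rw [if_pos htop.1, if_pos ⟨htop, rfl⟩]
      · have hne : ¬ (IsChainTop a.support S.1 ∧
            (G S : Finset (Fin n)) = (G S : Finset (Fin n))) := fun h => htop h.1
        rw [if_neg hne]
        by_cases hSa : S.1 ⊆ a.support
        · rw [if_pos hSa]
          by_contra hne
          exact htop (isChainTop_of_coeff_ne_zero (hf S) hSa hne)
        · rw [if_neg hSa]
    · rw [if_neg hS, if_neg fun h => hS h.2, coeff_zero]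
  · refine (Finset.sum_eq_zero fun S _ => if_neg ?_).symm
    rintro ⟨htop, rfl⟩
    exact hT ((psiIter_subset (hG S)).trans htop.1)

/-- Uniqueness of the representation in the explicit decomposition. -/
theorem eq_zero_of_augDiff_indexSum (hk : n / 2 ≤ k)
    (hG : ∀ S : KoszulIndex n k, psiIter (S.1.card - k) S.1 = some (G S : Finset (Fin n)))
    {f : KoszulIndex n k → MvPolynomial (Fin n) K}
    (hf : ∀ S, f S ∈ supported K (koszulZ S.1 : Set (Fin n)))
    (h : augDiff K n (indexSum G f) = 0) (S : KoszulIndex n k) : f S = 0 := by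
  classical
  have hcomp : ∀ a, component a (indexSum G f) = 0 := by
    intro a
    obtain ⟨u, hu, he⟩ := exists_component_eq_faceBoundary (indexSum_mem f) h a
    refine eq_zero_of_eq_faceBoundary (incidence K) (fun i U _ => incidence_ne_zero i U)
      faceBoundary_faceBoundary (by omega : n < 2 * (k + 1)) (fun T hT => ?_) hu he
    rw [component_indexSum hG hf]
    refine Finset.sum_eq_zero fun S _ => if_neg ?_
    intro hS
    exact hT ((evenFace_iff hG).2 ⟨S, hS⟩)
  ext b
  rw [coeff_zero]
  by_contra hne
  have hsub : b + faceExp S.1 - faceExp S.1 = b := add_tsub_cancel_right _ _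
  have hSs : S.1 ⊆ (b + faceExp S.1).support := faceExp_le_iff.1 le_add_self
  have htop : IsChainTop (b + faceExp S.1).support S.1 :=
    isChainTop_of_coeff_ne_zero (hf S) hSs (by rwa [hsub])
  have h0 := congrFun (hcomp (b + faceExp S.1)) (G S)
  rw [component_indexSum hG hf, Finset.sum_eq_single S] at h0
  · rw [if_pos ⟨htop, rfl⟩, hsub] at h0
    exact hne h0
  · intro S' _ hS'
    refine if_neg fun hc => hS' ?_
    exact eq_of_coe_eq_of_isChainTop hG hc.1 htop hc.2
  · simp

/-- A combination of faces at even distance, placed in one multidegree, has a representation in the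
explicit decomposition. -/
theorem exists_indexSum_eq_ofComponent
    (hG : ∀ S : KoszulIndex n k, psiIter (S.1.card - k) S.1 = some (G S : Finset (Fin n)))
    (a : Fin n →₀ ℕ) {g : Finset (Fin n) → K} (hg : g ∈ chainsOn K (EvenFace a.support k)) :
    ∃ f : KoszulIndex n k → MvPolynomial (Fin n) K,
      (∀ S, f S ∈ supported K (koszulZ S.1 : Set (Fin n))) ∧ indexSum G f = ofComponent a g := by
  classical
  refine ⟨fun S => if IsChainTop a.support S.1 then monomial (a - faceExp S.1) (g (G S)) else 0,
    fun S => ?_, ?_⟩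
  · dsimp only
    split_ifs with h
    · rw [mem_supported]
      intro s hs
      obtain ⟨d, hd, hsd⟩ := (mem_vars_iff_mem_support s).1 hs
      obtain rfl := Finset.mem_singleton.1 (support_monomial_subset hd)
      refine (isChainTop_iff.1 h).2 ?_
      rw [Finsupp.mem_support_iff, Finsupp.tsub_apply] at hsd
      rw [Finsupp.mem_support_iff]
      omega
    · exact Subalgebra.zero_mem _
  · refine (wedgeBasis K n).ext_elem fun T => ?_
    rw [repr_indexSum, repr_ofComponent]
    by_cases hT : EvenFace a.support k T
    · obtain ⟨S, hS, rfl⟩ := (evenFace_iff hG).1 hT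
      rw [if_pos hT.1, Finset.sum_eq_single S]
      · rw [if_pos rfl, if_pos hS, monomial_mul, mul_one]
        congr 2
        ext i
        have h1 := faceExp_le_iff.2 hS.1 i
        have h2 : i ∈ (G S : Finset (Fin n)) → i ∈ S.1 := fun h => psiIter_subset (hG S) h
        simp only [Finsupp.add_apply, Finsupp.tsub_apply, faceExp_apply, Finset.mem_sdiff] at h1 ⊢
        by_cases hi : i ∈ (G S : Finset (Fin n))
        · simp [hi, h2 hi]
        · by_cases hi' : i ∈ S.1
          · simp only [hi, hi', if_true, if_false, not_false_eq_true, and_self] at h1 ⊢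
            omega
          · simp [hi, hi']
      · intro S' _ hS'
        split_ifs with h1 h2
        · exact absurd (eq_of_coe_eq_of_isChainTop hG h2 hS h1) hS'
        · exact zero_mul _
        · rfl
      · simp
    · rw [hg T hT, map_zero, ite_self]
      refine Finset.sum_eq_zero fun S _ => ?_
      split_ifs with h1 h2
      · exact absurd ((evenFace_iff hG).2 ⟨S, h2, h1⟩) hT
      · exact zero_mul _
      · rfl

theorem indexSum_add (f g : KoszulIndex n k → MvPolynomial (Fin n) K) :
    indexSum G (f + g) = indexSum G f + indexSum G g := by
  simp [indexSum, add_mul, add_smul, Finset.sum_add_distrib]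

theorem monomial_smul_wedgeBasis (b : Fin n →₀ ℕ) (T : Finset (Fin n)) (c : K) :
    monomial b c • wedgeBasis K n T = ofComponent (b + faceExp T) (Pi.single T c) := by
  refine (wedgeBasis K n).ext_elem fun U => ?_
  rw [repr_ofComponent, map_smul, Module.Basis.repr_self, Finsupp.smul_apply, smul_eq_mul]
  by_cases hU : U = T
  · subst hU
    rw [Finsupp.single_eq_same, mul_one, if_pos (faceExp_le_iff.1 le_add_self),
      add_tsub_cancel_right, Pi.single_eq_same]
  · rw [Finsupp.single_eq_of_ne hU, Pi.single_eq_of_ne hU, mul_zero, map_zero, ite_self]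

/-- Existence of the representation in the explicit decomposition. -/
theorem exists_augDiff_indexSum_eq
    (hG : ∀ S : KoszulIndex n k, psiIter (S.1.card - k) S.1 = some (G S : Finset (Fin n)))
    {w : KoszulAlgebra K n}
    (hw : w ∈ ⋀[MvPolynomial (Fin n) K]^k (Fin n → MvPolynomial (Fin n) K)) :
    ∃ f : KoszulIndex n k → MvPolynomial (Fin n) K,
      (∀ S, f S ∈ supported K (koszulZ S.1 : Set (Fin n))) ∧
        augDiff K n (indexSum G f) = augDiff K n w := by
  have hzero : ∃ f : KoszulIndex n k → MvPolynomial (Fin n) K,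
      (∀ S, f S ∈ supported K (koszulZ S.1 : Set (Fin n))) ∧
        augDiff K n (indexSum G f) = augDiff K n 0 :=
    ⟨0, fun S => Subalgebra.zero_mem _, by simp [indexSum]⟩
  have hadd : ∀ x y : KoszulAlgebra K n,
      (∃ f : KoszulIndex n k → MvPolynomial (Fin n) K,
        (∀ S, f S ∈ supported K (koszulZ S.1 : Set (Fin n))) ∧
          augDiff K n (indexSum G f) = augDiff K n x) →
      (∃ f : KoszulIndex n k → MvPolynomial (Fin n) K,
        (∀ S, f S ∈ supported K (koszulZ S.1 : Set (Fin n))) ∧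
          augDiff K n (indexSum G f) = augDiff K n y) →
      ∃ f : KoszulIndex n k → MvPolynomial (Fin n) K,
        (∀ S, f S ∈ supported K (koszulZ S.1 : Set (Fin n))) ∧
          augDiff K n (indexSum G f) = augDiff K n (x + y) := by
    rintro x y ⟨f, hf, hfx⟩ ⟨g, hg, hgy⟩
    exact ⟨f + g, fun S => Subalgebra.add_mem _ (hf S) (hg S), by
      rw [indexSum_add, map_add, map_add, hfx, hgy]⟩
  rw [← (wedgeBasis K n).sum_repr w]
  refine Finset.sum_induction _ _ hadd hzero fun T _ => ?_
  by_cases hT : T.card = k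
  swap
  · rw [mem_exteriorPower_iff.1 hw T hT, zero_smul]
    exact hzero
  induction (wedgeBasis K n).repr w T using MvPolynomial.induction_on' with
  | add p q hp hq => rw [add_smul]; exact hadd _ _ hp hq
  | monomial b c =>
    rw [monomial_smul_wedgeBasis]
    have hmem : Pi.single T c ∈ chainsOn K fun U => U ⊆ (b + faceExp T).support ∧ U.card = k :=
      single_mem_chainsOn ⟨faceExp_le_iff.1 le_add_self, hT⟩ c
    obtain ⟨g, hg, _, ⟨u, hu, rfl⟩, hgu⟩ := Submodule.mem_sup.1
      (chainsOn_le_sup (incidence K) (fun i U _ => incidence_ne_zero i U) _ k hmem)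
    obtain ⟨f, hf, hfg⟩ := exists_indexSum_eq_ofComponent hG _ hg
    refine ⟨f, hf, ?_⟩
    rw [← hgu, ofComponent_add, map_add,
      augDiff_ofComponent_faceBoundary (chainsOn_mono (fun _ h => h.1) hu), add_zero, hfg]

theorem ofComponent_mem_koszulTotalGrading (a : Fin n →₀ ℕ) (g : Finset (Fin n) → K) :
    ((ofComponent a g, 0) : KoszulTotal K n) ∈ koszulTotalGrading K n fun i => (a i : ℤ) := by
  have : ((ofComponent a g, 0) : KoszulTotal K n) = ∑ T ∈ a.support.powerset,
      g T • ((monomial (a - faceExp T) (1 : K) • wedgeBasis K n T, 0) : KoszulTotal K n) := by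
    rw [Prod.ext_iff, Prod.fst_sum, Prod.snd_sum]
    refine ⟨Finset.sum_congr rfl fun T _ => ?_, by simp⟩
    rw [Prod.smul_fst, ← smul_assoc, smul_monomial, smul_eq_mul, mul_one]
  rw [this]
  refine Submodule.sum_mem _ fun T hT => Submodule.smul_mem _ _ (Submodule.subset_span (Or.inl ?_))
  refine ⟨a - faceExp T, T, fun i => ?_, by rw [wedgeBasis_eq T rfl]⟩
  have h := faceExp_le_iff.2 (Finset.mem_powerset.1 hT) i
  rw [Finsupp.tsub_apply, Nat.cast_sub h, setDegree, faceExp_apply]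
  split_ifs <;> simp

theorem faceExp_sdiff_add {S T : Finset (Fin n)} (h : T ⊆ S) :
    faceExp (S \ T) + faceExp T = faceExp S := by
  ext i
  simp only [Finsupp.add_apply, faceExp_apply, Finset.mem_sdiff]
  by_cases hi : i ∈ T
  · simp [hi, h hi]
  · simp [hi]

theorem smul_koszulGen_mem_koszulGrading {S : Finset (Fin n)} (T : Set.powersetCard (Fin n) k)
    (hTS : (T : Finset (Fin n)) ⊆ S) :
    (∏ i ∈ S \ (T : Finset (Fin n)), (X i : MvPolynomial (Fin n) K)) • koszulGen K n k T ∈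
      koszulGrading K n k (setDegree S) := by
  change (((∏ i ∈ S \ (T : Finset (Fin n)), (X i : MvPolynomial (Fin n) K)) •
    koszulGen K n k T : koszulSyzygy K n k) : KoszulTotal K n) ∈ koszulTotalGrading K n (setDegree S)
  have hdeg : setDegree S = fun i => (faceExp S i : ℤ) := by
    ext i
    simp [setDegree, faceExp_apply]
  rw [Submodule.coe_smul, koszulGen_coe, ← map_smul, augDiff_apply, prod_X_eq_monomial,
    monomial_smul_wedgeBasis, faceExp_sdiff_add hTS, ← add_zero (koszulDiff K n _),
    ← zero_add ((maxHomIdeal K n).mkQ _), ← Prod.mk_add_mk]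
  refine Submodule.add_mem _ ?_ ?_
  · rw [koszulDiff_ofComponent, hdeg]
    · exact ofComponent_mem_koszulTotalGrading _ _
    · exact single_mem_chainsOn (by rwa [support_faceExp]) 1
  · rw [algebraMapInv_eq_repr, repr_ofComponent, if_pos (Finset.empty_subset _)]
    by_cases hT : (∅ : Finset (Fin n)) = T
    · rw [← hT, Pi.single_eq_same]
      have h0 : faceExp S - faceExp ∅ = faceExp S := by
        ext i
        simp [faceExp_apply]
      rw [h0]
      rcases S.eq_empty_or_nonempty with rfl | ⟨i, hi⟩
      · refine Submodule.subset_span (Or.inr ⟨?_, ?_⟩)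
        · ext i
          simp [setDegree]
        · have : faceExp (∅ : Finset (Fin n)) = 0 := by
            ext i
            simp [faceExp_apply]
          rw [this]
          rfl
      · rw [← prod_X_eq_monomial, Submodule.mkQ_apply, (Submodule.Quotient.mk_eq_zero _).2]
        · exact Submodule.zero_mem _
        · rw [← Finset.mul_prod_erase _ _ hi]
          exact Ideal.mul_mem_right _ _ (X_mem_maxHomIdeal i)
    · rw [Pi.single_eq_of_ne hT, map_zero, map_zero]
      exact Submodule.zero_mem _

/-- The explicit family indexed by `𝒮` is a Stanley decomposition. -/
theorem isStanleyDecomposition_koszul (hk : n / 2 ≤ k)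
    (hG : ∀ S : KoszulIndex n k, psiIter (S.1.card - k) S.1 = some (G S : Finset (Fin n))) :
    IsStanleyDecomposition (koszulGrading K n k) (fun S : KoszulIndex n k => koszulZ S.1)
      (fun S : KoszulIndex n k =>
        (∏ i ∈ S.1 \ (G S : Finset (Fin n)), (MvPolynomial.X i : MvPolynomial (Fin n) K)) •
          koszulGen K n k (G S)) := by
  refine .of_unique_repr
    (fun S => ⟨_, smul_koszulGen_mem_koszulGrading _ (psiIter_subset (hG S))⟩)
    (fun f hf h => eq_zero_of_augDiff_indexSum hk hG hf ?_) ?_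
  · rw [augDiff_indexSum, h, Submodule.coe_zero]
  · rintro ⟨_, w, rfl⟩
    obtain ⟨f, hf, h⟩ := exists_augDiff_indexSum_eq hG w.2
    exact ⟨f, hf, Subtype.ext ((augDiff_indexSum f).symm.trans h)⟩

end KoszulDecomposition

/-! ### `M(n,k)` is not free -/

section NotFree

open MvPolynomial

variable {K : Type*} [Field K] {n k : ℕ}

theorem koszulDiff_wedgeBasis (T : Finset (Fin n)) :
    koszulDiff K n (wedgeBasis K n T) = ∑ i ∈ T,
      (((wedgeSign i (T.erase i) : ℤ) : MvPolynomial (Fin n) K) * X i) •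
        wedgeBasis K n (T.erase i) := by
  refine (wedgeBasis K n).ext_elem fun U => ?_
  rw [repr_koszulDiff]
  simp only [map_sum, map_smul, Module.Basis.repr_self, Finsupp.coe_finsetSum, Finset.sum_apply,
    Finsupp.smul_apply, Finsupp.single_apply, smul_eq_mul, mul_ite, mul_one, mul_zero]
  rw [← Finset.sum_filter, ← Finset.sum_filter]
  have hs : Uᶜ.filter (fun i => T = insert i U) = T.filter fun i => T.erase i = U := by
    ext i
    simp only [Finset.mem_filter, Finset.mem_compl]
    constructor
    · rintro ⟨h, rfl⟩
      exact ⟨Finset.mem_insert_self _ _, Finset.erase_insert h⟩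
    · rintro ⟨h, rfl⟩
      exact ⟨Finset.notMem_erase _ _, (Finset.insert_erase h).symm⟩
  rw [hs]
  refine Finset.sum_congr rfl fun i hi => ?_
  rw [(Finset.mem_filter.1 hi).2]

/-- `M(n,k)` has no Stanley decomposition in which every `Z_i` consists of all variables, as it
would be free on the `m_i`: by the relation `∂∂(e_A) = 0` with `|A| = k + 1`, the coordinates of the
minimal generators `∂(e_{A \ {i}})` would lie in the maximal ideal. -/
theorem IsStanleyDecomposition.exists_ne_univ (hkn : k < n) {ι : Type*} [Fintype ι] [DecidableEq ι]
    {Z : ι → Finset (Fin n)} {m : ι → koszulSyzygy K n k}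
    (h : IsStanleyDecomposition (koszulGrading K n k) Z m) : ∃ i, Z i ≠ Finset.univ := by
  by_contra! hZ
  obtain ⟨A, -, hA⟩ := Finset.exists_subset_card_eq
    (by simpa using hkn : k + 1 ≤ (Finset.univ : Finset (Fin n)).card)
  have hcard : ∀ i ∈ A, (A.erase i).card = k := fun i hi => by
    have := Finset.card_erase_add_one hi
    omega
  have hrep : ∀ i ∈ A, ∃ f : ι → MvPolynomial (Fin n) K,
      ∑ j, f j • (m j : KoszulTotal K n) = augDiff K n (wedgeBasis K n (A.erase i)) := by
    intro i hi
    obtain ⟨f, hf⟩ := h.exists_repr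
      ⟨augDiff K n (wedgeBasis K n (A.erase i)), ⟨_, wedgeBasis_mem (hcard i hi)⟩, rfl⟩
    refine ⟨f, ?_⟩
    have := congrArg (fun x : koszulSyzygy K n k => (x : KoszulTotal K n)) hf
    simpa using this
  choose! f hf using hrep
  have hrel : ∀ j, ∑ i ∈ A,
      (((wedgeSign i (A.erase i) : ℤ) : MvPolynomial (Fin n) K) * X i) * f i j = 0 := by
    refine h.eq_zero_of_sum_eq_zero (fun j => ?_) ?_
    · rw [hZ j, mem_supported]
      simp
    · refine Subtype.ext ?_
      have h0 := augDiff_koszulDiff (wedgeBasis K n A)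
      rw [koszulDiff_wedgeBasis, map_sum] at h0
      rw [Submodule.coe_zero, ← h0]
      simp only [Submodule.coe_sum, Submodule.coe_smul, Finset.sum_smul]
      rw [Finset.sum_comm]
      refine Finset.sum_congr rfl fun i hi => ?_
      rw [map_smul, ← hf i hi, Finset.smul_sum]
      exact Finset.sum_congr rfl fun j _ => mul_smul _ _ _
  obtain ⟨i, hi⟩ : A.Nonempty := Finset.card_pos.1 (by omega)
  -- comparing the coefficients of `X_i` in the relation
  have hconst : ∀ j, constantCoeff (f i j) = 0 := by
    intro j
    have h0 := congrArg (coeff (Finsupp.single i 1)) (hrel j)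
    rw [coeff_sum, Finset.sum_eq_single i] at h0
    · rw [← map_intCast (C : K →+* MvPolynomial (Fin n) K), mul_assoc, coeff_C_mul, coeff_X_mul',
        if_pos (by simp), tsub_self, coeff_zero] at h0
      exact (mul_eq_zero.1 h0).resolve_left (incidence_ne_zero i (A.erase i))
    · intro l _ hl
      rw [← map_intCast (C : K →+* MvPolynomial (Fin n) K), mul_assoc, coeff_C_mul, coeff_X_mul',
        if_neg (by simpa using hl), mul_zero]
    · exact fun hc => absurd hi hc
  choose w hw using fun j => (m j).2
  -- now `e_{A \ {i}}` lies in the maximal ideal times the exterior power, modulo boundaries; its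
  -- coefficient in its own multidegree shows that it does not
  set x := wedgeBasis K n (A.erase i) - ∑ j, f i j • (w j : KoszulAlgebra K n)
  have hx : x ∈ ⋀[MvPolynomial (Fin n) K]^k (Fin n → MvPolynomial (Fin n) K) :=
    Submodule.sub_mem _ (wedgeBasis_mem (hcard i hi))
      (Submodule.sum_mem _ fun j _ => Submodule.smul_mem _ _ (w j).2)
  have hx0 : augDiff K n x = 0 := by
    rw [map_sub, map_sum, ← hf i hi, sub_eq_zero]
    refine Finset.sum_congr rfl fun j _ => ?_
    rw [map_smul, ← koszulBoundary_apply, hw]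
  obtain ⟨u, hu, hxu⟩ := exists_component_eq_faceBoundary hx hx0 (faceExp (A.erase i))
  have hu0 : u = 0 := by
    ext T
    refine hu T fun hT => ?_
    have := Finset.card_le_card hT.1
    rw [support_faceExp, hcard i hi] at this
    omega
  have hval := congrFun hxu (A.erase i)
  rw [hu0, map_zero, component, support_faceExp, if_pos subset_rfl, tsub_self,
    ← constantCoeff_eq] at hval
  simp [x, hconst] at hval

end NotFree

/-! ### Depth of direct sums of the rings `K[Z]` -/

section Depth

open RingTheory.Sequence

section DirectSumQuotients

variable {R : Type*} [CommRing R] {ι : Type*} [Finite ι] (I : ι → Ideal R)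

theorem mem_smul_top_directSum_quotient_iff (J : Ideal R) (x : DirectSum ι fun i => R ⧸ I i) :
    x ∈ (J • ⊤ : Submodule R (DirectSum ι fun i => R ⧸ I i)) ↔
      ∀ i r, x i = Ideal.Quotient.mk (I i) r → r ∈ J ⊔ I i := by
  classical
  have := Fintype.ofFinite ι
  constructor
  · intro hx i r hr
    have h1 : x i ∈ (J ⊔ I i).map (Ideal.Quotient.mk (I i)) := by
      clear hr
      induction hx using Submodule.smul_induction_on' with
      | smul a ha y _ =>
        obtain ⟨q, hq⟩ := Ideal.Quotient.mk_surjective (y i)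
        rw [DirectSum.smul_apply, ← hq]
        change Ideal.Quotient.mk (I i) (a * q) ∈ _
        exact Ideal.mem_map_of_mem _ (Ideal.mem_sup_left (J.mul_mem_right _ ha))
      | add y _ z _ hy hz => exact Ideal.add_mem _ hy hz
    rw [hr, Ideal.mem_quotient_iff_mem le_sup_right] at h1
    exact h1
  · intro h
    rw [← DirectSum.sum_univ_of x]
    refine Submodule.sum_mem _ fun i _ => ?_
    obtain ⟨r, hr⟩ := Ideal.Quotient.mk_surjective (x i)
    obtain ⟨a, ha, b, hb, rfl⟩ := Submodule.mem_sup.1 (h i r hr.symm)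
    have e : DirectSum.of (fun i => R ⧸ I i) i (x i) =
        a • DirectSum.of (fun i => R ⧸ I i) i 1 := by
      rw [← hr, map_add, Ideal.Quotient.eq_zero_iff_mem.2 hb, add_zero]
      refine (congrArg _ ?_).trans ((DirectSum.lof R ι (fun i => R ⧸ I i) i).map_smul a 1)
      rw [Algebra.smul_def, mul_one]
      rfl
    rw [e]
    exact Submodule.smul_mem_smul ha Submodule.mem_top

theorem isWeaklyRegular_directSum_quotient_iff (rs : List R) :
    IsWeaklyRegular (DirectSum ι fun i => R ⧸ I i) rs ↔
      ∀ t (h : t < rs.length) i p, rs[t] * p ∈ Ideal.ofList (rs.take t) ⊔ I i →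
        p ∈ Ideal.ofList (rs.take t) ⊔ I i := by
  classical
  rw [isWeaklyRegular_iff]
  refine forall₂_congr fun t h => ?_
  rw [isSMulRegular_quotient_iff_mem_of_smul_mem]
  simp only [mem_smul_top_directSum_quotient_iff]
  constructor
  · intro H i p hp
    refine H (DirectSum.of (fun i => R ⧸ I i) i (Ideal.Quotient.mk _ p)) (fun j q hq => ?_) i p
      (DirectSum.of_eq_same _ _)
    rw [DirectSum.smul_apply] at hq
    rcases eq_or_ne j i with rfl | hj
    · rw [DirectSum.of_eq_same] at hq
      have h1 : rs[t] * p - q ∈ I j := (Ideal.Quotient.eq).1 hq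
      have h2 := Ideal.sub_mem _ hp (Ideal.mem_sup_right h1)
      rwa [sub_sub_cancel] at h2
    · rw [DirectSum.of_eq_of_ne _ _ _ hj, smul_zero] at hq
      exact Ideal.mem_sup_right (Ideal.Quotient.eq_zero_iff_mem.1 hq.symm)
  · intro H x hx i p hp
    refine H i p (hx i (rs[t] * p) ?_)
    rw [DirectSum.smul_apply, hp]
    rfl

end DirectSumQuotients

open MvPolynomial

variable (K : Type*) [Field K] {n : ℕ}

/-- The ideal `(X_j | j ∉ Z)`, whose residue class ring is `K[Z]`. -/
noncomputable abbrev coordIdeal (Z : Finset (Fin n)) : Ideal (MvPolynomial (Fin n) K) :=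
  Ideal.span ((X : Fin n → MvPolynomial (Fin n) K) '' {j | j ∉ Z})

variable {K}

theorem coordIdeal_le (Z : Finset (Fin n)) : coordIdeal K Z ≤ maxHomIdeal K n :=
  Ideal.span_mono (Set.image_subset_range _ _)

theorem maxHomIdeal_ne_top : maxHomIdeal K n ≠ ⊤ := fun h => by
  have := constantCoeff_of_mem_maxHomIdeal (h ▸ Submodule.mem_top : (1 : _) ∈ maxHomIdeal K n)
  simp at this

/-- A regular sequence on the direct sum is regular on each summand `K[Z_i]`, hence has at most
`dim K[Z_i]` elements. -/
theorem decompositionDepth_le {ι : Type*} [Finite ι] {Z : ι → Finset (Fin n)} {i : ι}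
    (hi : Z i ≠ Finset.univ) : decompositionDepth K Z ≤ ((n - 1 : ℕ) : ℕ∞) := by
  refine iSup₂_le fun rs hrs => ?_
  obtain ⟨hm, hreg⟩ := hrs
  have hreg' := (isWeaklyRegular_directSum_quotient_iff _ rs).1 hreg
  obtain ⟨s, hs⟩ : ∃ s, s ∉ Z i := by
    by_contra! hc
    exact hi (Finset.eq_univ_iff_forall.2 hc)
  -- one variable is missing from `Z i`, and each element of the sequence lowers the dimension
  have key : ∀ t ≤ rs.length, ringKrullDim
      (MvPolynomial (Fin n) K ⧸ Ideal.ofList (rs.take t) ⊔ coordIdeal K (Z i)) + (t + 1 : ℕ) ≤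
        (n : ℕ) := by
    intro t
    induction t with
    | zero =>
      intro _
      have hd : ringKrullDim (MvPolynomial (Fin n) K) = (n : ℕ) := by
        rw [MvPolynomial.ringKrullDim_of_isNoetherianRing, ringKrullDim_eq_zero_of_field]
        simp
      rw [← hd]
      exact ringKrullDim_succ_le_of_surjective (Ideal.Quotient.mk _) Ideal.Quotient.mk_surjective
        (mem_nonZeroDivisors_of_ne_zero (X_ne_zero s))
        (Ideal.Quotient.eq_zero_iff_mem.2 (Ideal.mem_sup_right (Ideal.subset_span ⟨s, hs, rfl⟩)))
    | succ t ih =>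
      intro ht
      refine le_trans ?_ (ih (by omega))
      have hle : Ideal.ofList (rs.take t) ⊔ coordIdeal K (Z i) ≤
          Ideal.ofList (rs.take (t + 1)) ⊔ coordIdeal K (Z i) :=
        sup_le_sup_right (Ideal.span_mono fun r hr => by
          rw [List.take_succ_eq_append_getElem ht]
          exact List.mem_append_left _ hr) _
      have h1 : ringKrullDim (MvPolynomial (Fin n) K ⧸ Ideal.ofList (rs.take (t + 1)) ⊔
          coordIdeal K (Z i)) + 1 ≤ ringKrullDim (MvPolynomial (Fin n) K ⧸
            Ideal.ofList (rs.take t) ⊔ coordIdeal K (Z i)) := by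
        refine ringKrullDim_succ_le_of_surjective (Ideal.Quotient.factor hle)
          (Ideal.Quotient.factor_surjective hle) (r := Ideal.Quotient.mk _ rs[t]) ?_ ?_
        · rw [mem_nonZeroDivisors_iff_right]
          intro x hx
          obtain ⟨p, rfl⟩ := Ideal.Quotient.mk_surjective x
          rw [← map_mul, Ideal.Quotient.eq_zero_iff_mem, mul_comm] at hx
          exact Ideal.Quotient.eq_zero_iff_mem.2 (hreg' t ht i p hx)
        · rw [Ideal.Quotient.factor_mk, Ideal.Quotient.eq_zero_iff_mem]
          refine Ideal.mem_sup_left (Ideal.subset_span ?_)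
          rw [List.take_succ_eq_append_getElem ht]
          exact List.mem_append_right _ (List.mem_singleton_self _)
      calc _ = ringKrullDim (MvPolynomial (Fin n) K ⧸ Ideal.ofList (rs.take (t + 1)) ⊔
              coordIdeal K (Z i)) + 1 + (t + 1 : ℕ) := by
            rw [Nat.cast_succ (t + 1), add_assoc, add_comm (1 : WithBot ℕ∞)]
        _ ≤ _ := by gcongr
  have h1 := key rs.length le_rfl
  have hne : Ideal.ofList (rs.take rs.length) ⊔ coordIdeal K (Z i) ≠ ⊤ := by
    refine ne_top_of_le_ne_top maxHomIdeal_ne_top (sup_le ?_ (coordIdeal_le _))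
    rw [List.take_length]
    exact Ideal.span_le.2 hm
  have := Ideal.Quotient.nontrivial_iff.2 hne
  have h2 := ringKrullDim_nonneg_of_nontrivial
    (R := MvPolynomial (Fin n) K ⧸ Ideal.ofList (rs.take rs.length) ⊔ coordIdeal K (Z i))
  have h3 : ((rs.length + 1 : ℕ) : WithBot ℕ∞) ≤ (n : ℕ) :=
    le_trans (le_add_of_nonneg_left h2) h1
  have h4 : rs.length + 1 ≤ n := by exact_mod_cast h3
  exact_mod_cast (by omega : rs.length ≤ n - 1)

/-- If the substitution `X_j ↦ v_j` does not change residue classes modulo `L` and kills `L`, then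
`L` is its kernel. -/
theorem mem_of_aeval_eq_zero {L : Ideal (MvPolynomial (Fin n) K)}
    {v : Fin n → MvPolynomial (Fin n) K} (h : ∀ j, X j - v j ∈ L) {p : MvPolynomial (Fin n) K}
    (hp : aeval v p = 0) : p ∈ L := by
  have e : (Ideal.Quotient.mkₐ K L).comp (aeval v) = Ideal.Quotient.mkₐ K L := by
    refine MvPolynomial.algHom_ext fun j => ?_
    rw [AlgHom.comp_apply, aeval_X]
    exact (Ideal.Quotient.eq.2 (h j)).symm
  have := DFunLike.congr_fun e p
  rw [AlgHom.comp_apply, hp, map_zero] at this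
  exact Ideal.Quotient.eq_zero_iff_mem.1 this.symm

/-- The linear forms `X_1 - X_2, …, X_{n-1} - X_n`. -/
noncomputable def differences (K : Type*) [Field K] (n : ℕ) : List (MvPolynomial (Fin n) K) :=
  List.ofFn fun t : Fin (n - 1) => X ⟨t, by omega⟩ - X ⟨t + 1, by omega⟩

/-- The differences of consecutive variables form a regular sequence on every ring `K[Z]` with at
most one variable missing: the ideals involved are kernels of substitutions of variables. -/
theorem mem_of_differences_mul_mem {Z : Finset (Fin n)} (hZ : ∀ s ∉ Z, ∀ s' ∉ Z, s = s') (t : ℕ)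
    (ht : t < (differences K n).length) (p : MvPolynomial (Fin n) K)
    (hp : (differences K n)[t] * p ∈
      Ideal.ofList ((differences K n).take t) ⊔ coordIdeal K Z) :
    p ∈ Ideal.ofList ((differences K n).take t) ⊔ coordIdeal K Z := by
  classical
  have hlen : (differences K n).length = n - 1 := by simp [differences]
  have hget : ∀ a (ha : a < (differences K n).length), (differences K n)[a] =
      X ⟨a, by omega⟩ - X ⟨a + 1, by omega⟩ := fun a ha => by simp [differences]
  set L := Ideal.ofList ((differences K n).take t) ⊔ coordIdeal K Z
  have htn : t + 1 < n := by omega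
  let t₀ : Fin n := ⟨t, by omega⟩
  have hX : ∀ s ∉ Z, (X s : MvPolynomial (Fin n) K) ∈ L := fun s hs =>
    Ideal.mem_sup_right (Ideal.subset_span ⟨s, hs, rfl⟩)
  have hdiff : ∀ a (ha : a < t),
      (X ⟨a, by omega⟩ - X ⟨a + 1, by omega⟩ : MvPolynomial (Fin n) K) ∈ L := by
    intro a ha
    rw [← hget a (by omega)]
    exact Ideal.mem_sup_left (Ideal.subset_span (List.mem_take_iff_getElem.2 ⟨a, by omega, rfl⟩))
  have htel : ∀ d a (ha : a + d = t), (X ⟨a, by omega⟩ - X t₀ : MvPolynomial (Fin n) K) ∈ L := by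
    intro d
    induction d with
    | zero =>
      rintro a rfl
      simp [t₀]
    | succ d ih =>
      intro a ha
      have := Ideal.add_mem _ (hdiff a (by omega)) (ih (a + 1) (by omega))
      rwa [sub_add_sub_cancel] at this
  -- substitution of representatives modulo `L`: the variables up to `X t₀` are congruent, and they
  -- lie in `L` if one of them is missing from `Z`
  let v : Fin n → MvPolynomial (Fin n) K := fun j =>
    if j ≤ t₀ then (if ∃ s ∉ Z, s ≤ t₀ then 0 else X t₀) else if j ∈ Z then X j else 0
  have hle : ∀ j ≤ t₀, (X j - X t₀ : MvPolynomial (Fin n) K) ∈ L := fun j hj =>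
    htel (t - j) j (by have : (j : ℕ) ≤ t := hj; omega)
  have hv : ∀ j, X j - v j ∈ L := by
    intro j
    simp only [v]
    split_ifs with h1 h2 h3
    · obtain ⟨s, hs, hst⟩ := h2
      have := Ideal.add_mem _ (Ideal.sub_mem _ (hle j h1) (hle s hst)) (hX s hs)
      rwa [sub_sub_sub_cancel_right, sub_add_cancel, ← sub_zero (X j)] at this
    · exact hle j h1
    · rw [sub_self]
      exact Ideal.zero_mem _
    · rw [sub_zero]
      exact hX j h3
  have hker : L ≤ RingHom.ker (aeval v : MvPolynomial (Fin n) K →ₐ[K] MvPolynomial (Fin n) K) := by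
    refine sup_le (Ideal.span_le.2 ?_) (Ideal.span_le.2 ?_)
    · intro r hr
      obtain ⟨a, ha, rfl⟩ := List.mem_take_iff_getElem.1 hr
      have ha' : a < t := by omega
      have h1 : (⟨a, by omega⟩ : Fin n) ≤ t₀ := ha'.le
      have h2 : (⟨a + 1, by omega⟩ : Fin n) ≤ t₀ := ha'
      rw [hget, SetLike.mem_coe, RingHom.mem_ker, map_sub, aeval_X, aeval_X]
      simp only [v, if_pos h1, if_pos h2, sub_self]
    · rintro _ ⟨s, hs, rfl⟩
      rw [SetLike.mem_coe, RingHom.mem_ker, aeval_X]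
      have hs' : s ∉ Z := hs
      simp only [v, if_neg hs']
      split_ifs with h1 h2
      · rfl
      · exact absurd ⟨s, hs', h1⟩ h2
      · rfl
  have h0 := RingHom.mem_ker.1 (hker hp)
  rw [map_mul] at h0
  refine mem_of_aeval_eq_zero hv ((mul_eq_zero.1 h0).resolve_left ?_)
  have h1 : ¬ (⟨t + 1, htn⟩ : Fin n) ≤ t₀ := by simp [t₀]
  rw [hget, map_sub, aeval_X, aeval_X]
  have e : v ⟨t, by omega⟩ = if ∃ s ∉ Z, s ≤ t₀ then 0 else X t₀ := if_pos (le_refl t₀)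
  rw [e, sub_eq_zero]
  simp only [v, if_neg h1]
  split_ifs with h2 h3 h3
  · exact (X_ne_zero _).symm
  · obtain ⟨s, hs, hst⟩ := h2
    exact absurd (hZ s hs _ h3 ▸ hst) h1
  · intro hc
    have := X_injective hc
    simp [t₀, Fin.ext_iff] at this
  · exact X_ne_zero _

theorem le_decompositionDepth {ι : Type*} [Finite ι] {Z : ι → Finset (Fin n)}
    (hZ : ∀ i, ∀ s ∉ Z i, ∀ s' ∉ Z i, s = s') :
    ((n - 1 : ℕ) : ℕ∞) ≤ decompositionDepth K Z := by
  refine le_iSup₂_of_le (differences K n) ⟨fun r hr => ?_, ?_⟩ (by simp [differences])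
  · obtain ⟨t, rfl⟩ := (List.mem_ofFn' _ _).1 hr
    exact Ideal.sub_mem _ (X_mem_maxHomIdeal _) (X_mem_maxHomIdeal _)
  · exact (isWeaklyRegular_directSum_quotient_iff _ _).2 fun t ht i p hp =>
      mem_of_differences_mul_mem (hZ i) t ht p hp

end Depth

/-! ### The Stanley depth of `M(n,k)` -/

section StanleyDepth

variable {K : Type*} [Field K] {n : ℕ}

theorem IsStanleyDecomposition.reindex {M : Type*} [AddCommGroup M] [Module K M]
    [Module (MvPolynomial (Fin n) K) M] [IsScalarTower K (MvPolynomial (Fin n) K) M]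
    {𝓜 : (Fin n → ℤ) → Submodule K M} {ι κ : Type*} [Fintype ι] [DecidableEq ι] [Fintype κ]
    [DecidableEq κ] {Z : ι → Finset (Fin n)} {m : ι → M} (h : IsStanleyDecomposition 𝓜 Z m)
    (e : κ ≃ ι) : IsStanleyDecomposition 𝓜 (Z ∘ e) (m ∘ e) where
  homogeneous i := h.homogeneous (e i)
  free i := h.free (e i)
  isInternal := by
    refine DirectSum.isInternal_submodule_of_iSupIndep_of_iSup_eq_top
      (h.isInternal.submodule_iSupIndep.comp e.injective) ?_
    rw [← h.isInternal.submodule_iSup_eq_top]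
    exact e.iSup_comp (g := fun i => stanleySpace (K := K) (Z i) (m i))

end StanleyDepth

theorem theorem1 (K : Type*) [Field K] (n k : ℕ) (hk : n / 2 ≤ k) (hkn : k < n) :
    stanleyDepth (koszulGrading K n k) = ((n - 1 : ℕ) : ℕ∞) ∧
    IsLexicographicMapping (psi (n := n)) ∧
    ∃ G : KoszulIndex n k → Set.powersetCard (Fin n) k,
      (∀ S : KoszulIndex n k, psiIter (S.1.card - k) S.1 = some (G S : Finset (Fin n))) ∧
      (∀ S : KoszulIndex n k,
        (∏ i ∈ S.1 \ (G S : Finset (Fin n)), (MvPolynomial.X i : MvPolynomial (Fin n) K)) •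
          koszulGen K n k (G S) ∈ koszulGrading K n k (setDegree S.1)) ∧
      IsStanleyDecomposition (koszulGrading K n k)
        (fun S : KoszulIndex n k => koszulZ S.1)
        (fun S : KoszulIndex n k =>
          (∏ i ∈ S.1 \ (G S : Finset (Fin n)), (MvPolynomial.X i : MvPolynomial (Fin n) K)) •
            koszulGen K n k (G S)) := by
  choose G hG using exists_psiIter_eq_powersetCard (n := n) hk
  have hdec := isStanleyDecomposition_koszul (K := K) hk hG
  refine ⟨le_antisymm (sSup_le ?_) ?_, isLexicographicMapping_psi, G, hG,
    fun S => smul_koszulGen_mem_koszulGrading _ (psiIter_subset (hG S)), hdec⟩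
  · rintro _ ⟨r, Z, m, h, rfl⟩
    obtain ⟨i, hi⟩ := h.exists_ne_univ hkn
    exact decompositionDepth_le hi
  · have e := (Fintype.equivFin (KoszulIndex n k)).symm
    refine le_trans ?_ (le_sSup ⟨_, _, _, hdec.reindex e, rfl⟩)
    exact le_decompositionDepth fun i s hs s' hs' => card_koszulZ_compl_le_one _ hs hs'
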